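/- Let $n\ge 0$ and let $I(\mathbb R^n)$ be the isometry group of Euclidean space; every $\gamma\in I(\mathbb R^n)$ is uniquely of the form $\gamma=BL_b$, $\gamma x=B(x+b)$, with $B\in O(n)$ and $b\in\mathbb R^n$. A Bieberbach group is a discrete, cocompact, torsion-free subgroup $\Gamma\subset I(\mathbb R^n)$. Its holonomy group $F$ is the image of $\Gamma$ under $BL_b\mapsto B$, its translation lattice is $\Lambda=\{\lambda\in\mathbb R^n: L_\lambda\in\Gamma\}$, its dual lattice is $\Lambda^*=\{v\in\mathbb R^n: v\cdot\lambda\in\mathbb Z\text{ for all }\lambda\in\Lambda\}$, and $M_\Gamma=\Gamma\backslash\mathbb R^n$ is the compact flat Riemannian manifold with the metric induced from $\mathbb R^n$. For $B\in F$ and a real number $\mu\ge 0$ set $$e_{\mu,B}(\Gamma)=\sum_{v\in\Lambda^*,\ \|v\|^2=\mu,\ Bv=v}e^{2\pi i\,v\cdot b},\qquad\text{where } BL_b\in\Gamma$$ (this does not depend on the choice of $b$), and for $0\le p\le n$ let $\operatorname{tr}_p(B)$ be the trace of $B$ on the exterior power $\Lambda^p(\mathbb R^n)$. Two such manifolds are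 called $p$-isospectral if every real number has the same multiplicity as an eigenvalue of their Hodge Laplacians $d\delta+\delta d$ on smooth $p$-forms (multiplicity $0$ meaning that it is not an eigenvalue). **Theorem 3.1.** (1) Let $\Gamma\subset I(\mathbb R^n)$ be a Bieberbach group with holonomy group $F$. Then $F$ is finite and, for all real $\mu\ge0$ and all $0\le p\le n$, the set $\{v\in\Lambda^*:\|v\|^2=\mu\}$ is finite and the multiplicity $d_{p,\mu}(\Gamma)$ of the eigenvalue $4\pi^2\mu$ of the Hodge Laplacian on smooth $p$-forms of $M_\Gamma$ is finite and given by $$d_{p,\mu}(\Gamma)=|F|^{-1}\sum_{B\in F}\operatorname{tr}_p(B)\,e_{\mu,B}(\Gamma).$$ (2) Let $\Gamma,\Gamma'\subset I(\mathbb R^n)$ be Bieberbach groups with holonomy groups $F,F'$, and let $0\le p\le n$. If there is a bijection $\Phi:F\to F'$ such that $$\operatorname{tr}_p(B)\,e_{\mu,B}(\Gamma)=\operatorname{tr}_p(\Phi(B))\,e_{\mu,\Phi(B)}(\Gamma')\qquad\text{for all }\mu\ge0\text{ and all }B\in F,$$ then $M_\Gamma$ and $M_{\Gamma'}$ are $p$-isospectral.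 -/

import Mathlib

open scoped ContDiff

noncomputable section

namespace FlatSpec

/-- Euclidean space `ℝⁿ`. -/
abbrev E (n : ℕ) : Type := EuclideanSpace ℝ (Fin n)

/-- The isometry group `I(ℝⁿ)`, with composition as multiplication. -/
abbrev Isom (n : ℕ) : Type := E n ≃ᵃⁱ[ℝ] E n

/-- The projection `I(ℝⁿ) → O(n)`, `B L_b ↦ B`. -/
def linPart (n : ℕ) : Isom n →* (E n ≃ₗᵢ[ℝ] E n) where
  toFun γ := γ.linearIsometryEquiv
  map_one' := rfl
  map_mul' _ _ := rfl

/-- The vector `b` in the decomposition `γ = B L_b`, that is `γ x = B (x + b)`. -/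
def transPart {n : ℕ} (γ : Isom n) : E n := (linPart n γ).symm (γ 0)

theorem apply_eq {n : ℕ} (γ : Isom n) (x : E n) : γ x = linPart n γ (x + transPart γ) := by
  have h := γ.map_vadd 0 x
  simp only [vadd_eq_add, add_zero] at h
  rw [h, map_add, transPart, LinearIsometryEquiv.apply_symm_apply]
  rfl

/-- The map `I(ℝⁿ) → End(ℝⁿ) × ℝⁿ`, `γ ↦ (B, γ 0)`, which induces the usual topology
on `I(ℝⁿ)`. -/
def isomEmb (n : ℕ) (γ : Isom n) : (E n →L[ℝ] E n) × E n :=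
  ((linPart n γ).toContinuousLinearEquiv.toContinuousLinearMap, γ 0)

/-- Two points of `ℝⁿ` are equivalent when they lie in the same `Γ`-orbit. -/
def orbitSetoid {n : ℕ} (Γ : Subgroup (Isom n)) : Setoid (E n) where
  r x y := ∃ γ ∈ Γ, γ x = y
  iseqv :=
    { refl := fun _ => ⟨1, Γ.one_mem, rfl⟩
      symm := by
        rintro x y ⟨γ, hγ, rfl⟩
        exact ⟨γ⁻¹, Γ.inv_mem hγ, γ.symm_apply_apply x⟩
      trans := by
        rintro x y z ⟨γ, hγ, rfl⟩ ⟨δ, hδ, rfl⟩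
        exact ⟨δ * γ, Γ.mul_mem hδ hγ, rfl⟩ }

/-- The quotient `M_Γ = Γ \ ℝⁿ`, with the quotient topology. -/
abbrev FlatMfd {n : ℕ} (Γ : Subgroup (Isom n)) : Type := Quotient (orbitSetoid Γ)

/-- The canonical projection `ℝⁿ → M_Γ`. -/
def proj {n : ℕ} (Γ : Subgroup (Isom n)) (x : E n) : FlatMfd Γ := Quotient.mk (orbitSetoid Γ) x

/-- A Bieberbach group: a discrete, cocompact, torsion-free subgroup of `I(ℝⁿ)`. -/
structure IsBieberbach {n : ℕ} (Γ : Subgroup (Isom n)) : Prop where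
  discrete : DiscreteTopology (isomEmb n '' (Γ : Set (Isom n)))
  cocompact : CompactSpace (FlatMfd Γ)
  torsionFree : ∀ γ ∈ Γ, γ ≠ 1 → ¬ IsOfFinOrder γ

/-- The translation lattice `Λ` of `Γ`: all `t` such that the translation `x ↦ t + x` is
in `Γ`. -/
def transLattice {n : ℕ} (Γ : Subgroup (Isom n)) : Set (E n) :=
  {t | AffineIsometryEquiv.constVAdd ℝ (E n) t ∈ Γ}

/-- The dual lattice `Λ*`. -/
def dualLattice {n : ℕ} (Γ : Subgroup (Isom n)) : Set (E n) :=
  {v | ∀ t ∈ transLattice Γ, ∃ k : ℤ, inner ℝ v t = (k : ℝ)}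

/-- The point group (holonomy group) `F` of `Γ`: the image of `Γ` in `O(n)`. -/
def pointGroup {n : ℕ} (Γ : Subgroup (Isom n)) : Subgroup (E n ≃ₗᵢ[ℝ] E n) :=
  Γ.map (linPart n)

/-- The sum of `exp (2πi v·b)` over all `v ∈ Λ*` with `‖v‖² = μ` and `Bv = v`, for the element
`γ = B L_b` of `Γ`. -/
def expSum {n : ℕ} (Γ : Subgroup (Isom n)) (μ : ℝ) (γ : Isom n) : ℂ :=
  ∑ᶠ v ∈ {v : E n | v ∈ dualLattice Γ ∧ ‖v‖ ^ 2 = μ ∧ linPart n γ v = v},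
    Complex.exp (2 * Real.pi * Complex.I * (inner ℝ v (transPart γ) : ℝ))

/-- `e_{μ,B}(Γ)` for `B ∈ F`, computed with some `γ = B L_b ∈ Γ`; by `eSum_eq` below the choice
of `γ` does not matter. -/
def eSum {n : ℕ} (Γ : Subgroup (Isom n)) (μ : ℝ) (B : pointGroup Γ) : ℂ :=
  expSum Γ μ (Subgroup.mem_map.mp B.2).choose

theorem expSum_congr {n : ℕ} (Γ : Subgroup (Isom n)) (μ : ℝ) {γ δ : Isom n} (hγ : γ ∈ Γ)
    (hδ : δ ∈ Γ) (h : linPart n γ = linPart n δ) : expSum Γ μ γ = expSum Γ μ δ := by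
  have key : transPart γ - transPart δ ∈ transLattice Γ := by
    have : AffineIsometryEquiv.constVAdd ℝ (E n) (transPart γ - transPart δ) = δ⁻¹ * γ := by
      ext1 x
      change (transPart γ - transPart δ) + x = δ.symm (γ x)
      rw [AffineIsometryEquiv.eq_symm_apply, apply_eq δ, apply_eq γ, h]
      congr 1
      abel
    change AffineIsometryEquiv.constVAdd ℝ (E n) _ ∈ Γ
    rw [this]
    exact Γ.mul_mem (Γ.inv_mem hδ) hγ
  unfold expSum
  rw [h]
  refine finsum_mem_congr rfl fun v hv => ?_
  obtain ⟨k, hk⟩ := hv.1 _ key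
  have : (inner ℝ v (transPart γ) : ℝ) = inner ℝ v (transPart δ) + k := by
    rw [← hk, inner_sub_right]; ring
  rw [this, Complex.exp_eq_exp_iff_exists_int]
  refine ⟨k, ?_⟩
  push_cast
  ring

theorem eSum_eq {n : ℕ} (Γ : Subgroup (Isom n)) (μ : ℝ) (B : pointGroup Γ) {γ : Isom n}
    (hγ : γ ∈ Γ) (h : linPart n γ = B) : eSum Γ μ B = expSum Γ μ γ := by
  have hs := (Subgroup.mem_map.mp B.2).choose_spec
  exact expSum_congr Γ μ hs.1 hγ (hs.2.trans h.symm)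

/-- `tr_p B`: the trace of `B` on the `p`-th exterior power of `ℝⁿ`. -/
def extTrace {n : ℕ} (p : ℕ) (B : E n ≃ₗᵢ[ℝ] E n) : ℝ :=
  LinearMap.trace ℝ (⋀[ℝ]^p (E n)) (exteriorPower.map p (B.toLinearEquiv : E n →ₗ[ℝ] E n))

/-- Complex valued alternating `p`-forms on `ℝⁿ`. -/
abbrev Alt (n p : ℕ) : Type := E n [⋀^Fin p]→L[ℝ] ℂ

/-- The codifferential of the Euclidean metric, `δα = - ∑ᵢ ι(eᵢ) ∂ᵢ α`. -/
def codiff {n p : ℕ} (α : E n → Alt n (p + 1)) (x : E n) : Alt n p :=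
  - ∑ i : Fin n, (fderiv ℝ α x (EuclideanSpace.basisFun (Fin n) ℝ i)).curryLeft
      (EuclideanSpace.basisFun (Fin n) ℝ i)

/-- The Hodge Laplacian `dδ + δd` of the Euclidean metric on `p`-forms (`δ = 0` on functions); it is
the nonnegative operator, written `-Δ_p` if `Δ = ∑ᵢ ∂ᵢ²` on functions. -/
def hodgeLaplacian {n : ℕ} : (p : ℕ) → (E n → Alt n p) → E n → Alt n p
  | 0, α => codiff (extDeriv α)
  | _ + 1, α => extDeriv (codiff α) + codiff (extDeriv α)

section linearity

variable {n p : ℕ}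

theorem contDiffAt_extDeriv {α : E n → Alt n p} {x : E n} (h : ContDiffAt ℝ ∞ α x) :
    ContDiffAt ℝ ∞ (extDeriv α) x := by
  let L : (E n →L[ℝ] Alt n p) →L[ℝ] Alt n (p + 1) :=
    ContinuousAlternatingMap.alternatizeUncurryFinCLM ℝ (E n) ℂ
  exact L.contDiff.contDiffAt.comp x (h.fderiv_right (m := ∞) le_rfl)

theorem contDiffAt_codiff {α : E n → Alt n (p + 1)} {x : E n} (h : ContDiffAt ℝ ∞ α x) :
    ContDiffAt ℝ ∞ (codiff α) x := by
  have h1 : ContDiffAt ℝ ∞ (fderiv ℝ α) x := h.fderiv_right (m := ∞) le_rfl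
  unfold codiff
  refine ContDiffAt.neg (ContDiffAt.sum fun i _ => ?_)
  have h2 : ContDiffAt ℝ ∞
      (fun y => fderiv ℝ α y (EuclideanSpace.basisFun (Fin n) ℝ i)) x :=
    h1.clm_apply contDiffAt_const
  let L : Alt n (p + 1) →L[ℝ] Alt n p :=
    (ContinuousLinearMap.apply ℝ (Alt n p) (EuclideanSpace.basisFun (Fin n) ℝ i)).comp
      (ContinuousAlternatingMap.curryLeftLI (𝕜 := ℝ) (E := E n) (F := ℂ)
        (n := p)).toContinuousLinearMap
  exact L.contDiff.contDiffAt.comp x h2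

theorem codiff_add {α β : E n → Alt n (p + 1)} {x : E n} (h : DifferentiableAt ℝ α x)
    (h' : DifferentiableAt ℝ β x) : codiff (α + β) x = codiff α x + codiff β x := by
  simp only [codiff, fderiv_add h h']
  rw [← neg_add, ← Finset.sum_add_distrib]
  rfl

theorem codiff_smul (c : ℂ) (α : E n → Alt n (p + 1)) (x : E n) (h : DifferentiableAt ℝ α x) :
    codiff (c • α) x = c • codiff α x := by
  simp only [codiff, fderiv_const_smul h c, smul_neg, Finset.smul_sum]
  rfl

theorem extDeriv_csmul (c : ℂ) (α : E n → Alt n p) (x : E n) (h : DifferentiableAt ℝ α x) :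
    extDeriv (c • α) x = c • extDeriv α x := by
  ext v
  simp [extDeriv, fderiv_const_smul h c, ContinuousAlternatingMap.alternatizeUncurryFin_apply,
    Finset.mul_sum]

theorem codiff_congr {α β : E n → Alt n (p + 1)} {x : E n} (h : α =ᶠ[nhds x] β) :
    codiff α x = codiff β x := by
  simp only [codiff, h.fderiv_eq]

theorem eventually_differentiableAt {F : Type*} [NormedAddCommGroup F] [NormedSpace ℝ F]
    {α : E n → F} {x : E n} (h : ContDiffAt ℝ ∞ α x) : ∀ᶠ y in nhds x, DifferentiableAt ℝ α y :=
  ((h.of_le (m := 1) (by norm_cast)).eventually (by simp)).mono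
    fun _ hy => hy.differentiableAt (by simp)

theorem hodgeLaplacian_add : (p : ℕ) → {α β : E n → Alt n p} → {x : E n} →
    ContDiffAt ℝ ∞ α x → ContDiffAt ℝ ∞ β x →
    hodgeLaplacian p (α + β) x = hodgeLaplacian p α x + hodgeLaplacian p β x
  | 0, α, β, x, h, h' => by
    have e : extDeriv (α + β) =ᶠ[nhds x] extDeriv α + extDeriv β := by
      filter_upwards [eventually_differentiableAt h, eventually_differentiableAt h'] with y hy hy'
      exact extDeriv_add hy hy'
    simp only [hodgeLaplacian]
    rw [codiff_congr e, codiff_add ((contDiffAt_extDeriv h).differentiableAt (by simp))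
      ((contDiffAt_extDeriv h').differentiableAt (by simp))]
  | p + 1, α, β, x, h, h' => by
    have e : extDeriv (α + β) =ᶠ[nhds x] extDeriv α + extDeriv β := by
      filter_upwards [eventually_differentiableAt h, eventually_differentiableAt h'] with y hy hy'
      exact extDeriv_add hy hy'
    have e' : codiff (α + β) =ᶠ[nhds x] codiff α + codiff β := by
      filter_upwards [eventually_differentiableAt h, eventually_differentiableAt h'] with y hy hy'
      exact codiff_add hy hy'
    simp only [hodgeLaplacian, Pi.add_apply]
    rw [codiff_congr e, e'.extDeriv_eq, codiff_add ((contDiffAt_extDeriv h).differentiableAt (by simp))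
      ((contDiffAt_extDeriv h').differentiableAt (by simp)),
      extDeriv_add ((contDiffAt_codiff h).differentiableAt (by simp))
      ((contDiffAt_codiff h').differentiableAt (by simp))]
    abel

theorem hodgeLaplacian_smul (c : ℂ) : (p : ℕ) → {α : E n → Alt n p} → {x : E n} →
    ContDiffAt ℝ ∞ α x →
    hodgeLaplacian p (c • α) x = c • hodgeLaplacian p α x
  | 0, α, x, h => by
    have e : extDeriv (c • α) =ᶠ[nhds x] c • extDeriv α := by
      filter_upwards [eventually_differentiableAt h] with y hy
      exact extDeriv_csmul c α y hy
    simp only [hodgeLaplacian]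
    rw [codiff_congr e, codiff_smul c _ _ ((contDiffAt_extDeriv h).differentiableAt (by simp))]
  | p + 1, α, x, h => by
    have e : extDeriv (c • α) =ᶠ[nhds x] c • extDeriv α := by
      filter_upwards [eventually_differentiableAt h] with y hy
      exact extDeriv_csmul c α y hy
    have e' : codiff (c • α) =ᶠ[nhds x] c • codiff α := by
      filter_upwards [eventually_differentiableAt h] with y hy
      exact codiff_smul c α y hy
    simp only [hodgeLaplacian, Pi.add_apply]
    rw [codiff_congr e, e'.extDeriv_eq,
      codiff_smul c _ _ ((contDiffAt_extDeriv h).differentiableAt (by simp)),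
      extDeriv_csmul c _ _ ((contDiffAt_codiff h).differentiableAt (by simp)), smul_add]

end linearity

/-- The atlas of `M_Γ`: the charts are all local inverses of the projection `ℝⁿ → M_Γ`. The metric
of `M_Γ` is the one for which the projection is a local isometry, so in each of these charts it is
the Euclidean metric. -/
def flatAtlas {n : ℕ} (Γ : Subgroup (Isom n)) : Set (OpenPartialHomeomorph (FlatMfd Γ) (E n)) :=
  {φ | ∀ x ∈ φ.target, φ.symm x = proj Γ x}

/-- Smooth complex valued `p`-forms on `M_Γ`: a family of smooth forms `α_φ` on the ranges of the
charts `φ`, where `α_φ` is the pullback of `α_ψ` under the change of charts `ψ ∘ φ⁻¹`. Values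
outside the range of a chart are normalized to `0`. -/
def forms {n : ℕ} (Γ : Subgroup (Isom n)) (p : ℕ) :
    Submodule ℂ (flatAtlas Γ → E n → Alt n p) where
  carrier := {α |
    (∀ φ, ContDiffOn ℝ ∞ (α φ) φ.1.target) ∧
    (∀ φ, ∀ x ∉ φ.1.target, α φ x = 0) ∧
    ∀ φ ψ, ∀ x ∈ φ.1.target, φ.1.symm x ∈ ψ.1.source →
      α φ x = (α ψ (ψ.1 (φ.1.symm x))).compContinuousLinearMap
        (fderiv ℝ (fun y => ψ.1 (φ.1.symm y)) x)}
  zero_mem' := by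
    refine ⟨fun φ => contDiffOn_const, fun φ x _ => rfl, fun φ ψ x _ _ => ?_⟩
    ext v
    simp
  add_mem' := by
    rintro α β ⟨h1, h2, h3⟩ ⟨k1, k2, k3⟩
    refine ⟨fun φ => (h1 φ).add (k1 φ), fun φ x hx => ?_, fun φ ψ x hx hx' => ?_⟩
    · simp [h2 φ x hx, k2 φ x hx]
    · ext v
      simp [h3 φ ψ x hx hx', k3 φ ψ x hx hx']
  smul_mem' := by
    rintro c α ⟨h1, h2, h3⟩
    refine ⟨fun φ => (h1 φ).const_smul c, fun φ x hx => ?_, fun φ ψ x hx hx' => ?_⟩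
    · simp [h2 φ x hx]
    · ext v
      simp [h3 φ ψ x hx hx']

theorem forms_contDiffAt {n p : ℕ} {Γ : Subgroup (Isom n)} (α : forms Γ p) (φ : flatAtlas Γ)
    {x : E n} (hx : x ∈ φ.1.target) : ContDiffAt ℝ ∞ (α.1 φ) x :=
  (α.2.1 φ).contDiffAt (φ.1.open_target.mem_nhds hx)

/-- The eigenspace of the Hodge Laplacian of `M_Γ` on smooth `p`-forms: the forms `α` which satisfy
`(dδ + δd) α = ν α` in every chart. -/
def eigenspace {n : ℕ} (Γ : Subgroup (Isom n)) (p : ℕ) (ν : ℝ) : Submodule ℂ (forms Γ p) where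
  carrier := {α | ∀ φ : flatAtlas Γ, ∀ x ∈ φ.1.target,
    hodgeLaplacian p (α.1 φ) x = (ν : ℂ) • α.1 φ x}
  zero_mem' := by
    intro φ x hx
    have h := hodgeLaplacian_smul (n := n) 0 p (forms_contDiffAt (0 : forms Γ p) φ hx)
    rw [zero_smul ℂ (hodgeLaplacian p _ x)] at h
    change hodgeLaplacian p (0 : E n → Alt n p) x = _ • (0 : Alt n p)
    change hodgeLaplacian p ((0 : ℂ) • (0 : E n → Alt n p)) x = 0 at h
    have h0 : (0 : ℂ) • (0 : E n → Alt n p) = 0 := by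
      ext y v
      simp
    have h1 : (ν : ℂ) • (0 : Alt n p) = 0 := by
      ext v
      simp
    rw [h0] at h
    rw [h, h1]
  add_mem' := by
    intro α β hα hβ φ x hx
    change hodgeLaplacian p (α.1 φ + β.1 φ) x = (ν : ℂ) • (α.1 φ x + β.1 φ x)
    rw [hodgeLaplacian_add p (forms_contDiffAt α φ hx) (forms_contDiffAt β φ hx), hα φ x hx,
      hβ φ x hx, smul_add]
  smul_mem' := by
    intro c α hα φ x hx
    change hodgeLaplacian p (c • α.1 φ) x = (ν : ℂ) • (c • α.1 φ x)
    rw [hodgeLaplacian_smul c p (forms_contDiffAt α φ hx), hα φ x hx, smul_comm]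

/-- The multiplicity of the real number `ν` as an eigenvalue of the Hodge Laplacian on `p`-forms of
`M_Γ`: the complex dimension of the eigenspace of complex valued forms (equivalently, the real
dimension of the eigenspace of real forms). It is a cardinal, and `0` if `ν` is not an eigenvalue. -/
def multiplicity {n : ℕ} (Γ : Subgroup (Isom n)) (p : ℕ) (ν : ℝ) : Cardinal :=
  Module.rank ℂ (eigenspace Γ p ν)

/-- `M_Γ` and `M_Γ'` are `p`-isospectral: each real number is an eigenvalue of the two Hodge
Laplacians on `p`-forms with the same multiplicity. -/
def IsIsospectral {n : ℕ} (Γ Γ' : Subgroup (Isom n)) (p : ℕ) : Prop :=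
  ∀ ν : ℝ, multiplicity Γ p ν = multiplicity Γ' p ν

end FlatSpec

end

/-!
The multiplicities are computed on the universal cover `ℝⁿ` of `M_Γ`, by Fourier analysis on the
torus `ℝⁿ/Λ` and character theory of the finite holonomy group `F`.

*Finiteness of `F`.* By `IsBieberbach.linOp_eq_one`, proved along the lines of P. Buser's geometric
argument, an element of `Γ` whose linear part has distance at most `1/2` from the identity is a
translation. Hence the linear parts form a separated subset of a compact set, so `F` is finite, and
then `Λ` has finite index in `Γ` and is a lattice of full rank (`IsBieberbach.exists_basis`).

*From `M_Γ` to `ℝⁿ`.* As `Γ` acts freely and properly discontinuously, there are charts around every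
point, and all changes of charts are locally elements of `Γ`. So eigenforms on `M_Γ` are the same as
`Γ`-invariant eigenforms on `ℝⁿ` (`IsBieberbach.multiplicity_eq`). There the Hodge Laplacian acts on
each coefficient as `-∑ᵢ ∂ᵢ²` (`hodgeLaplacian_eq`).

*Fourier analysis.* A `Γ`-invariant form is `Λ`-periodic. By Green's formula on the torus, the
Fourier coefficient at `v ∈ Λ*` of an eigenform for `4π²μ` vanishes unless `‖v‖² = μ`. Therefore the
eigenform is a finite sum `∑ᵥ exp (2πi v·x) cᵥ` with constant `cᵥ ∈ Λᵖ(ℝⁿ)* ⊗ ℂ`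
(`eq_sum_planeWave`).

*Trace formula.* The pull-back by `B L_b ∈ Γ` maps the family `c` to
`u ↦ exp (2πi u·b) B*(c_{Bu})`; it depends on `B` only, which gives a representation of `F` whose
invariants are the eigenforms. Only vectors with `Bu = u` contribute to its trace, which is
`tr_p(B) e_{μ,B}(Γ)` (`trace_coeffPullback`), and the dimension of the invariants is the average of
the traces over `F`. The formula is valid for every real `μ`, and both sides vanish for `μ < 0`, so
isospectrality follows by comparing the averages for `Γ` and `Γ'`.
-/

namespace FlatSpec

/-! ### Bieberbach's first theorem -/

/-- The linear part of an isometry as a bounded operator. -/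
noncomputable abbrev linOp {n : ℕ} (γ : Isom n) : E n →L[ℝ] E n := (isomEmb n γ).1

section isometries

variable {n : ℕ}

theorem linOp_apply (γ : Isom n) (x : E n) : linOp γ x = linPart n γ x := rfl

theorem apply_eq_linOp_add (γ : Isom n) (x : E n) : γ x = linOp γ x + γ 0 := by
  have h := γ.map_vadd 0 x
  rwa [vadd_eq_add, vadd_eq_add, add_zero] at h

theorem norm_linOp_apply (γ : Isom n) (x : E n) : ‖linOp γ x‖ = ‖x‖ :=
  (linPart n γ).norm_map x

theorem linOp_mul (γ δ : Isom n) : linOp (γ * δ) = linOp γ * linOp δ := rfl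

theorem linOp_one : linOp (1 : Isom n) = 1 := rfl

theorem linOp_mul_inv (γ : Isom n) : linOp γ * linOp γ⁻¹ = 1 := by
  rw [← linOp_mul, mul_inv_cancel, linOp_one]

theorem linOp_inv_mul (γ : Isom n) : linOp γ⁻¹ * linOp γ = 1 := by
  rw [← linOp_mul, inv_mul_cancel, linOp_one]

theorem isom_mul_apply (γ δ : Isom n) (x : E n) : (γ * δ) x = γ (δ x) := rfl

theorem isom_inv_apply_self (γ : Isom n) (x : E n) : γ⁻¹ (γ x) = x := γ.symm_apply_apply x

theorem isom_apply_inv_self (γ : Isom n) (x : E n) : γ (γ⁻¹ x) = x := γ.apply_symm_apply x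

theorem isom_norm_sub (γ : Isom n) (x y : E n) : ‖γ x - γ y‖ = ‖x - y‖ := by
  rw [← dist_eq_norm, ← dist_eq_norm, γ.dist_map]

theorem norm_inv_apply_zero (γ : Isom n) : ‖γ⁻¹ 0‖ = ‖γ 0‖ := by
  have h := isom_norm_sub γ (γ⁻¹ 0) 0
  rw [isom_apply_inv_self, zero_sub, norm_neg, sub_zero] at h
  exact h.symm

theorem norm_linOp_le (γ : Isom n) : ‖linOp γ‖ ≤ 1 :=
  ContinuousLinearMap.opNorm_le_bound _ zero_le_one fun x => by rw [norm_linOp_apply, one_mul]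

theorem norm_linOp_mul (γ : Isom n) (T : E n →L[ℝ] E n) : ‖linOp γ * T‖ = ‖T‖ := by
  refine le_antisymm ?_ ?_
  · calc _ ≤ ‖linOp γ‖ * ‖T‖ := norm_mul_le _ _
      _ ≤ 1 * ‖T‖ := by gcongr; exact norm_linOp_le γ
      _ = _ := one_mul _
  · calc ‖T‖ = ‖linOp γ⁻¹ * (linOp γ * T)‖ := by rw [← mul_assoc, linOp_inv_mul, one_mul]
      _ ≤ ‖linOp γ⁻¹‖ * ‖linOp γ * T‖ := norm_mul_le _ _
      _ ≤ 1 * ‖linOp γ * T‖ := by gcongr; exact norm_linOp_le γ⁻¹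
      _ = _ := one_mul _

theorem norm_mul_linOp (γ : Isom n) (T : E n →L[ℝ] E n) : ‖T * linOp γ‖ = ‖T‖ := by
  refine le_antisymm ?_ ?_
  · calc _ ≤ ‖T‖ * ‖linOp γ‖ := norm_mul_le _ _
      _ ≤ ‖T‖ * 1 := by gcongr; exact norm_linOp_le γ
      _ = _ := mul_one _
  · calc ‖T‖ = ‖(T * linOp γ) * linOp γ⁻¹‖ := by rw [mul_assoc, linOp_mul_inv, mul_one]
      _ ≤ ‖T * linOp γ‖ * ‖linOp γ⁻¹‖ := norm_mul_le _ _
      _ ≤ ‖T * linOp γ‖ * 1 := by gcongr; exact norm_linOp_le γ⁻¹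
      _ = _ := mul_one _

theorem norm_linOp_mul_inv_sub_one (γ δ : Isom n) :
    ‖linOp (γ * δ⁻¹) - 1‖ = ‖linOp γ - linOp δ‖ := by
  rw [← linOp_mul_inv δ, linOp_mul, ← sub_mul, norm_mul_linOp]

theorem norm_linOp_inv_mul_sub_one (γ δ : Isom n) :
    ‖linOp (δ⁻¹ * γ) - 1‖ = ‖linOp γ - linOp δ‖ := by
  rw [← linOp_inv_mul δ, linOp_mul, ← mul_sub, norm_linOp_mul]

theorem isom_ext {γ δ : Isom n} (h : linOp γ = linOp δ) (h0 : γ 0 = δ 0) : γ = δ := by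
  ext1 x
  rw [apply_eq_linOp_add γ, apply_eq_linOp_add δ, h, h0]

end isometries

theorem finite_of_separated {X : Type*} [MetricSpace X] [ProperSpace X] {s : Set X}
    (hs : Bornology.IsBounded s) {ε : ℝ} (hε : 0 < ε)
    (hsep : ∀ x ∈ s, ∀ y ∈ s, dist x y < ε → x = y) : s.Finite := by
  obtain ⟨t, ht, hst⟩ := Metric.totallyBounded_iff.mp
    (hs.isCompact_closure.totallyBounded.subset subset_closure) (ε / 2) (half_pos hε)
  have h : s = ⋃ y ∈ t, s ∩ Metric.ball y (ε / 2) := by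
    rw [← Set.inter_iUnion₂]
    exact (Set.inter_eq_left.mpr hst).symm
  rw [h]
  refine ht.biUnion fun y _ => Set.Subsingleton.finite ?_
  rintro a ⟨ha, ha'⟩ b ⟨hb, hb'⟩
  refine hsep a ha b hb ?_
  calc dist a b ≤ dist a y + dist b y := dist_triangle_right _ _ _
    _ < ε / 2 + ε / 2 := add_lt_add ha' hb'
    _ = ε := add_halves ε

section discrete

variable {n : ℕ} {Γ : Subgroup (Isom n)}

theorem IsBieberbach.exists_separation (hΓ : IsBieberbach Γ) :
    ∃ ε > 0, ∀ γ ∈ Γ, ‖linOp γ - 1‖ < ε → ‖γ 0‖ < ε → γ = 1 := by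
  have hd := hΓ.discrete
  let e : isomEmb n '' (Γ : Set (Isom n)) := ⟨isomEmb n 1, 1, Γ.one_mem, rfl⟩
  have h1 : ({e} : Set (isomEmb n '' (Γ : Set (Isom n)))) ∈ nhds e :=
    (isOpen_discrete _).mem_nhds rfl
  obtain ⟨ε, hε, h⟩ := Metric.mem_nhds_iff.mp h1
  refine ⟨ε, hε, fun γ hγ hA ha => ?_⟩
  have h2 : (⟨isomEmb n γ, γ, hγ, rfl⟩ : isomEmb n '' (Γ : Set (Isom n))) ∈ Metric.ball e ε := by
    rw [Metric.mem_ball, Subtype.dist_eq, Prod.dist_eq, max_lt_iff, dist_eq_norm, dist_eq_norm]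
    refine ⟨hA, ?_⟩
    change ‖γ 0 - 0‖ < ε
    rwa [sub_zero]
  have h3 := congrArg Subtype.val (Set.mem_singleton_iff.mp (h h2))
  exact isom_ext (congrArg Prod.fst h3) (congrArg Prod.snd h3)

/-- Translating by the group makes the isolation of the identity uniform: distinct elements of `Γ`
have a fixed distance, so only finitely many move the origin by a bounded amount. -/
theorem IsBieberbach.finite_norm_le (hΓ : IsBieberbach Γ) (R : ℝ) :
    {γ : Isom n | γ ∈ Γ ∧ ‖γ 0‖ ≤ R}.Finite := by
  obtain ⟨ε, hε, h⟩ := hΓ.exists_separation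
  refine Set.Finite.of_finite_image (f := isomEmb n) ?_ ?_
  · refine finite_of_separated (ε := ε) ?_ hε ?_
    · refine (Metric.isBounded_closedBall (x := (0 : (E n →L[ℝ] E n) × E n))
        (r := max 1 R)).subset ?_
      rintro _ ⟨γ, ⟨-, hR⟩, rfl⟩
      rw [mem_closedBall_zero_iff, Prod.norm_def]
      exact max_le_max (norm_linOp_le γ) hR
    · rintro _ ⟨γ, ⟨hγ, -⟩, rfl⟩ _ ⟨δ, ⟨hδ, -⟩, rfl⟩ hd
      rw [Prod.dist_eq, max_lt_iff, dist_eq_norm, dist_eq_norm] at hd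
      have h1 : δ⁻¹ * γ = 1 := by
        refine h _ (Γ.mul_mem (Γ.inv_mem hδ) hγ) ?_ ?_
        · rw [norm_linOp_inv_mul_sub_one]
          exact hd.1
        · have := hd.2
          change ‖γ 0 - δ 0‖ < ε at this
          rw [← isom_norm_sub δ⁻¹, isom_inv_apply_self, sub_zero] at this
          exact this
      rw [inv_mul_eq_one.mp h1]
  · exact fun γ _ δ _ h => isom_ext (congrArg Prod.fst h) (congrArg Prod.snd h)

theorem IsBieberbach.exists_minimal (hΓ : IsBieberbach Γ) {P : Isom n → Prop}
    (hP : ∃ γ ∈ Γ, P γ) : ∃ γ ∈ Γ, P γ ∧ ∀ δ ∈ Γ, P δ → ‖γ 0‖ ≤ ‖δ 0‖ := by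
  obtain ⟨γ₀, h₀, hP₀⟩ := hP
  obtain ⟨γ, ⟨⟨hγ, hle⟩, hPγ⟩, hmin⟩ := Set.exists_min_image
    {γ : Isom n | (γ ∈ Γ ∧ ‖γ 0‖ ≤ ‖γ₀ 0‖) ∧ P γ} (fun γ => ‖γ 0‖)
    ((hΓ.finite_norm_le ‖γ₀ 0‖).subset fun _ h => h.1) ⟨γ₀, ⟨h₀, le_rfl⟩, hP₀⟩
  refine ⟨γ, hγ, hPγ, fun δ hδ hPδ => ?_⟩
  rcases le_total ‖δ 0‖ ‖γ₀ 0‖ with h | h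
  · exact hmin δ ⟨⟨hδ, h⟩, hPδ⟩
  · exact hle.trans h

theorem continuous_proj : Continuous (proj Γ) := continuous_quotient_mk'

theorem isOpenMap_proj : IsOpenMap (proj Γ) := by
  intro U hU
  have h : proj Γ ⁻¹' (proj Γ '' U) = ⋃ γ : Γ, (γ : Isom n) '' U := by
    ext x
    simp only [Set.mem_preimage, Set.mem_image, Set.mem_iUnion]
    constructor
    · rintro ⟨y, hy, hxy⟩
      obtain ⟨γ, hγ, h⟩ := Quotient.exact hxy
      exact ⟨⟨γ, hγ⟩, y, hy, h⟩
    · rintro ⟨⟨γ, hγ⟩, y, hy, h⟩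
      exact ⟨y, hy, Quotient.sound ⟨γ, hγ, h⟩⟩
  have : IsOpen (proj Γ ⁻¹' (proj Γ '' U)) := by
    rw [h]
    exact isOpen_iUnion fun γ => (γ : Isom n).toHomeomorph.isOpenMap U hU
  exact this

/-- Cocompactness says that every orbit is a net in `ℝⁿ`. -/
theorem IsBieberbach.exists_orbit_near (hΓ : IsBieberbach Γ) :
    ∃ D : ℝ, ∀ x : E n, ∃ γ ∈ Γ, ‖γ 0 - x‖ ≤ D := by
  have hc := hΓ.cocompact
  obtain ⟨t, ht⟩ := isCompact_univ.elim_finite_subcover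
    (fun k : ℕ => proj Γ '' Metric.ball 0 k)
    (fun k => isOpenMap_proj _ Metric.isOpen_ball) (by
      intro q _
      obtain ⟨x, rfl⟩ := Quotient.exists_rep q
      obtain ⟨k, hk⟩ := exists_nat_gt ‖x‖
      exact Set.mem_iUnion.mpr ⟨k, x, mem_ball_zero_iff.mpr hk, rfl⟩)
  refine ⟨∑ k ∈ t, (k : ℝ), fun x => ?_⟩
  obtain ⟨k, hk, y, hy, hxy⟩ := Set.mem_iUnion₂.mp (ht (Set.mem_univ (proj Γ x)))
  obtain ⟨γ, hγ, rfl⟩ := Quotient.exact hxy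
  refine ⟨γ, hγ, ?_⟩
  rw [isom_norm_sub, zero_sub, norm_neg]
  exact (mem_ball_zero_iff.mp hy).le.trans
    (Finset.single_le_sum (f := fun k : ℕ => (k : ℝ)) (fun _ _ => Nat.cast_nonneg _) hk)

/-- A Bieberbach group contains elements with linear part as close to the identity as desired which
move the origin approximately in a prescribed direction: compare two elements that move the origin
to points near `i u` and `j u` with `j` much larger than `i`. -/
theorem IsBieberbach.exists_near_direction (hΓ : IsBieberbach Γ) {u : E n} (hu : ‖u‖ = 1) {ε δ : ℝ}
    (hε : 0 < ε) (hδ : 0 < δ) :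
    ∃ β ∈ Γ, ‖linOp β - 1‖ ≤ ε ∧ β 0 ≠ 0 ∧ ‖β 0 - ‖β 0‖ • u‖ ≤ δ * ‖β 0‖ := by
  obtain ⟨D, hD⟩ := hΓ.exists_orbit_near
  choose β hβ hβD using fun k : ℕ => hD ((k : ℝ) • u)
  obtain ⟨_, -, φ, hφ, hlim⟩ := (isCompact_closedBall (0 : E n →L[ℝ] E n) 1).tendsto_subseq
    (x := fun k => linOp (β k)) fun k => mem_closedBall_zero_iff.mpr (norm_linOp_le _)
  obtain ⟨N, hN⟩ := Metric.cauchySeq_iff'.mp hlim.cauchySeq ε hε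
  set C : ℝ := D + ‖β (φ N) 0‖ with hC
  have hD0 : 0 ≤ D := (norm_nonneg _).trans (hβD 0)
  have hC0 : 0 ≤ C := by positivity
  obtain ⟨k, hk⟩ := exists_nat_gt (C + 2 * C / δ)
  set j := max N k with hj
  have hjk : (C + 2 * C / δ) < (φ j : ℝ) :=
    hk.trans_le (by exact_mod_cast (le_max_right N k).trans (hφ.id_le j))
  set γ := β (φ j) * (β (φ N))⁻¹ with hγ
  have h1 : ‖γ 0 - (φ j : ℝ) • u‖ ≤ C := by
    calc ‖γ 0 - (φ j : ℝ) • u‖ = ‖(γ 0 - β (φ j) 0) + (β (φ j) 0 - (φ j : ℝ) • u)‖ := by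
          congr 1; abel
      _ ≤ ‖γ 0 - β (φ j) 0‖ + ‖β (φ j) 0 - (φ j : ℝ) • u‖ := norm_add_le _ _
      _ ≤ ‖β (φ N) 0‖ + D := by
          refine add_le_add ?_ (hβD _)
          rw [hγ, isom_mul_apply, isom_norm_sub, sub_zero, norm_inv_apply_zero]
      _ = C := add_comm _ _
  have h2 : |‖γ 0‖ - (φ j : ℝ)| ≤ C := by
    have := (abs_norm_sub_norm_le (γ 0) ((φ j : ℝ) • u)).trans h1
    rwa [norm_smul, hu, mul_one, Real.norm_of_nonneg (Nat.cast_nonneg _)] at this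
  have h3 : 2 * C / δ < ‖γ 0‖ := by
    have := (abs_le.mp h2).1
    linarith
  refine ⟨γ, Γ.mul_mem (hβ _) (Γ.inv_mem (hβ _)), ?_, ?_, ?_⟩
  · rw [hγ, norm_linOp_mul_inv_sub_one, ← dist_eq_norm]
    exact (hN j (le_max_left _ _)).le
  · intro h0
    rw [h0, norm_zero] at h3
    exact absurd h3 (not_lt.mpr (by positivity))
  · calc ‖γ 0 - ‖γ 0‖ • u‖ = ‖(γ 0 - (φ j : ℝ) • u) + ((φ j : ℝ) - ‖γ 0‖) • u‖ := by
          congr 1; rw [sub_smul]; abel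
      _ ≤ ‖γ 0 - (φ j : ℝ) • u‖ + ‖((φ j : ℝ) - ‖γ 0‖) • u‖ := norm_add_le _ _
      _ ≤ C + C := by
          refine add_le_add h1 ?_
          rw [norm_smul, hu, mul_one, Real.norm_eq_abs, abs_sub_comm]
          exact h2
      _ ≤ δ * ‖γ 0‖ := by
          rw [div_lt_iff₀ hδ] at h3
          linarith

end discrete

/-- Spectral gap of an isometry `A ≠ 1`: `P` is the orthogonal projection to the space on which
`‖A x - x‖ / ‖x‖` is maximal, and `m'` bounds this quotient on the orthogonal complement. -/
theorem exists_maximal_rotation_space {n : ℕ} (A : E n ≃ₗᵢ[ℝ] E n) (T : E n →L[ℝ] E n)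
    (hT : ∀ x, T x = A x - x) (hT0 : T ≠ 0) :
    ∃ (P : E n →L[ℝ] E n) (m' : ℝ), 0 ≤ m' ∧ m' < ‖T‖ ∧ (∀ x, ‖P x‖ ≤ ‖x‖) ∧
      (∀ x, ‖x - P x‖ ≤ ‖x‖) ∧ (∀ x, P (T x) = T (P x)) ∧ (∀ x, ‖T (P x)‖ = ‖T‖ * ‖P x‖) ∧
      (∀ x, ‖T (x - P x)‖ ≤ m' * ‖x - P x‖) ∧ ∃ u, ‖u‖ = 1 ∧ P u = u := by
  have hT0' : 0 < ‖T‖ := norm_pos_iff.mpr hT0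
  -- `S = T*T = 2 - A - A⁻¹`
  let S : E n →ₗ[ℝ] E n := (2 : ℝ) • LinearMap.id - (A.toLinearEquiv : E n →ₗ[ℝ] E n)
    - (A.symm.toLinearEquiv : E n →ₗ[ℝ] E n)
  have hS : ∀ x, S x = (2 : ℝ) • x - A x - A.symm x := fun x => rfl
  have hAinner : ∀ x y : E n, inner ℝ (A x) y = inner ℝ x (A.symm y) := fun x y => by
    rw [← A.inner_map_map x (A.symm y), A.apply_symm_apply]
  have hSinner : ∀ x y, inner ℝ (S x) y = inner ℝ (T x) (T y) := by
    intro x y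
    have h1 : inner ℝ (A.symm x) y = inner ℝ x (A y) := by
      rw [← A.inner_map_map (A.symm x) y, A.apply_symm_apply]
    rw [hS, hT, hT, inner_sub_left, inner_sub_left, inner_sub_left, inner_sub_right,
      inner_sub_right, A.inner_map_map, inner_smul_left, h1]
    simp only [map_ofNat]
    ring
  have hSbound : ∀ x, ‖S x‖ ≤ ‖T‖ * ‖T x‖ := by
    intro x
    rcases eq_or_ne (S x) 0 with h | h
    · rw [h, norm_zero]; positivity
    · refine le_of_mul_le_mul_right ?_ (norm_pos_iff.mpr h)
      calc ‖S x‖ * ‖S x‖ = inner ℝ (S x) (S x) := (real_inner_self_eq_norm_mul_norm _).symm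
        _ = inner ℝ (T x) (T (S x)) := hSinner _ _
        _ ≤ ‖T x‖ * ‖T (S x)‖ := real_inner_le_norm _ _
        _ ≤ ‖T x‖ * (‖T‖ * ‖S x‖) := by gcongr; exact T.le_opNorm _
        _ = ‖T‖ * ‖T x‖ * ‖S x‖ := by ring
  -- a vector stretched as much as possible is an eigenvector of `T*T`
  have hmax : ∀ x, ‖T x‖ = ‖T‖ * ‖x‖ → S x = ‖T‖ ^ 2 • x := by
    intro x hx
    rw [← sub_eq_zero, ← norm_eq_zero, ← sq_eq_zero_iff]
    refine le_antisymm ?_ (sq_nonneg _)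
    have h1 : inner ℝ (S x) x = ‖T x‖ ^ 2 := by rw [hSinner, real_inner_self_eq_norm_sq]
    have h2 : ‖S x‖ ≤ ‖T‖ ^ 2 * ‖x‖ := (hSbound x).trans_eq (by rw [hx]; ring)
    have h3 : ‖S x‖ ^ 2 ≤ (‖T‖ ^ 2 * ‖x‖) ^ 2 := by gcongr
    rw [norm_sub_sq_real, inner_smul_right, h1, hx, norm_smul, norm_pow, norm_norm]
    linarith [h3, mul_pow ‖T‖ ‖x‖ 2]
  let K : Submodule ℝ (E n) := LinearMap.ker (S - ‖T‖ ^ 2 • LinearMap.id)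
  have hK : ∀ x, x ∈ K ↔ S x = ‖T‖ ^ 2 • x := fun x => by
    change S x - ‖T‖ ^ 2 • x = 0 ↔ _
    rw [sub_eq_zero]
  have hKA : ∀ x ∈ K, A x ∈ K := by
    intro x hx
    rw [hK] at *
    rw [← A.map_smul, ← hx, hS, hS]
    simp
  have hKA' : ∀ x ∈ K, A.symm x ∈ K := by
    intro x hx
    rw [hK] at *
    rw [← A.symm.map_smul, ← hx, hS, hS]
    simp
  have hKT : ∀ x ∈ K, T x ∈ K := fun x hx => by
    rw [hT]; exact K.sub_mem (hKA x hx) hx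
  have hKT' : ∀ x ∈ Kᗮ, T x ∈ Kᗮ := fun x hx => by
    rw [hT]
    refine Kᗮ.sub_mem ?_ hx
    rw [Submodule.mem_orthogonal'] at *
    intro y hy
    rw [hAinner]
    exact hx _ (hKA' y hy)
  have hKnorm : ∀ x ∈ K, ‖T x‖ = ‖T‖ * ‖x‖ := by
    intro x hx
    have h1 : ‖T x‖ ^ 2 = (‖T‖ * ‖x‖) ^ 2 := by
      rw [← real_inner_self_eq_norm_sq, ← hSinner, (hK x).mp hx, inner_smul_left,
        real_inner_self_eq_norm_sq, mul_pow]
      simp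
    exact (sq_eq_sq₀ (norm_nonneg _) (by positivity)).mp h1
  obtain ⟨m', hm0, hmT, hm⟩ : ∃ m', 0 ≤ m' ∧ m' < ‖T‖ ∧ ∀ x ∈ Kᗮ, ‖T x‖ ≤ m' * ‖x‖ := by
    have hcomp : IsCompact (Metric.sphere (0 : E n) 1 ∩ (Kᗮ : Set (E n))) :=
      (isCompact_sphere 0 1).inter_right Kᗮ.closed_of_finiteDimensional
    rcases (Metric.sphere (0 : E n) 1 ∩ (Kᗮ : Set (E n))).eq_empty_or_nonempty with he | hne
    · refine ⟨0, le_rfl, hT0', fun x hx => ?_⟩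
      rcases eq_or_ne x 0 with rfl | h
      · simp
      · have hmem : ‖x‖⁻¹ • x ∈ Metric.sphere (0 : E n) 1 ∩ (Kᗮ : Set (E n)) :=
          ⟨by rw [mem_sphere_zero_iff_norm, norm_smul, norm_inv, norm_norm,
            inv_mul_cancel₀ (norm_ne_zero_iff.mpr h)], Kᗮ.smul_mem _ hx⟩
        rw [he] at hmem
        exact hmem.elim
    · obtain ⟨x₀, ⟨hx₀, hx₀K⟩, hx₀max⟩ := hcomp.exists_isMaxOn hne
        (f := fun x => ‖T x‖) T.continuous.norm.continuousOn
      rw [mem_sphere_zero_iff_norm] at hx₀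
      refine ⟨‖T x₀‖, norm_nonneg _, ?_, fun x hx => ?_⟩
      · refine lt_of_le_of_ne ?_ fun h => ?_
        · simpa [hx₀] using T.le_opNorm x₀
        · have h1 : x₀ ∈ K := (hK _).mpr (hmax x₀ (by rw [hx₀, mul_one, h]))
          have h2 : x₀ = 0 := by
            have := Submodule.inner_right_of_mem_orthogonal h1 hx₀K
            exact inner_self_eq_zero.mp this
          rw [h2, norm_zero] at hx₀
          exact zero_ne_one hx₀
      · rcases eq_or_ne x 0 with rfl | h
        · simp
        · have hmem : ‖x‖⁻¹ • x ∈ Metric.sphere (0 : E n) 1 ∩ (Kᗮ : Set (E n)) :=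
            ⟨by rw [mem_sphere_zero_iff_norm, norm_smul, norm_inv, norm_norm,
              inv_mul_cancel₀ (norm_ne_zero_iff.mpr h)], Kᗮ.smul_mem _ hx⟩
          have := hx₀max hmem
          simp only [Set.mem_ofPred_eq, map_smul, norm_smul, norm_inv, norm_norm] at this
          rwa [inv_mul_le_iff₀ (norm_pos_iff.mpr h), mul_comm] at this
  -- otherwise `m' < ‖T‖` would bound `T` on the whole space
  have hKne : ∃ u ∈ K, u ≠ 0 := by
    by_contra! hcon
    have hbot : K = ⊥ := (Submodule.eq_bot_iff _).mpr hcon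
    refine absurd hmT (not_lt.mpr (T.opNorm_le_bound hm0 fun x => hm x ?_))
    rw [hbot, Submodule.bot_orthogonal_eq_top]
    trivial
  have hPm : ∀ x, K.starProjection x ∈ K := K.starProjection_apply_mem
  have hPo : ∀ x, x - K.starProjection x ∈ Kᗮ := fun x => K.sub_starProjection_mem_orthogonal x
  refine ⟨K.starProjection, m', hm0, hmT, K.norm_starProjection_apply_le, fun x => ?_, fun x => ?_,
    fun x => hKnorm _ (hPm x), fun x => hm _ (hPo x), ?_⟩
  · have := Kᗮ.norm_starProjection_apply_le x
    rwa [Submodule.starProjection_orthogonal_val] at this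
  · refine Submodule.eq_starProjection_of_mem_orthogonal (hKT _ (hPm x)) ?_
    rw [← map_sub]
    exact hKT' _ (hPo x)
  · obtain ⟨u, hu, hu0⟩ := hKne
    refine ⟨‖u‖⁻¹ • u, ?_, Submodule.starProjection_eq_self_iff.mpr (K.smul_mem _ hu)⟩
    rw [norm_smul, norm_inv, norm_norm, inv_mul_cancel₀ (norm_ne_zero_iff.mpr hu0)]

section bieberbach

variable {n : ℕ} {Γ : Subgroup (Isom n)}

theorem norm_commutator_sub_one_le (α β : Isom n) :
    ‖linOp (α * β * α⁻¹ * β⁻¹) - 1‖ ≤ 2 * ‖linOp α - 1‖ * ‖linOp β - 1‖ := by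
  have h : linOp (α * β * α⁻¹ * β⁻¹) - 1 = ((linOp α - 1) * (linOp β - 1)
      - (linOp β - 1) * (linOp α - 1)) * linOp (α⁻¹ * β⁻¹) := by
    have h1 : (1 : E n →L[ℝ] E n) = linOp β * linOp α * linOp (α⁻¹ * β⁻¹) := by
      rw [← linOp_mul, ← linOp_mul, ← linOp_one]
      congr 1
      group
    have h2 : linOp (α * β * α⁻¹ * β⁻¹) = linOp α * linOp β * linOp (α⁻¹ * β⁻¹) := by
      rw [← linOp_mul, ← linOp_mul, ← mul_assoc]
    have h3 : (linOp α - 1) * (linOp β - 1) - (linOp β - 1) * (linOp α - 1)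
        = linOp α * linOp β - linOp β * linOp α := by
      simp only [sub_mul, mul_sub, one_mul, mul_one]
      abel
    rw [h3, sub_mul, ← h2, ← h1]
  rw [h, norm_mul_linOp]
  calc _ ≤ ‖(linOp α - 1) * (linOp β - 1)‖ + ‖(linOp β - 1) * (linOp α - 1)‖ := norm_sub_le _ _
    _ ≤ ‖linOp α - 1‖ * ‖linOp β - 1‖ + ‖linOp β - 1‖ * ‖linOp α - 1‖ :=
        add_le_add (norm_mul_le _ _) (norm_mul_le _ _)
    _ = _ := by ring

/-- The origin is moved by the commutator `[α, β]` to `(A - 1) b` plus an error of size at most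
`‖B - 1‖ (‖a‖ + ‖b‖)`, where `α x = A x + a` and `β x = B x + b`. -/
theorem commutator_apply_zero (α β : Isom n) (hα : ‖linOp α - 1‖ ≤ 1 / 2) :
    ‖(α * β * α⁻¹ * β⁻¹) 0 - (linOp α - 1) (β 0)‖ ≤ ‖linOp β - 1‖ * (‖α 0‖ + ‖β 0‖) := by
  set c := α * β * α⁻¹ * β⁻¹ with hc
  have hcB : ‖linOp c - 1‖ ≤ ‖linOp β - 1‖ := by
    refine (norm_commutator_sub_one_le α β).trans ?_
    nlinarith [norm_nonneg (linOp β - 1)]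
  have h1 : c (β (α 0)) = α (β 0) := by
    rw [← isom_mul_apply, ← isom_mul_apply, ← isom_mul_apply]
    congr 1
    rw [hc]
    group
  have h2 : linOp c (linOp β (α 0)) = linOp α (linOp β (linOp α⁻¹ (α 0))) := by
    simp only [← mul_apply_eq_comp, ← linOp_mul]
    congr 2
    rw [hc]
    group
  have h3 : linOp α (linOp α⁻¹ (α 0)) = α 0 := by
    rw [← mul_apply_eq_comp, linOp_mul_inv, one_apply_eq_self]
  have h4 : c 0 - (linOp α - 1) (β 0) =
      linOp α ((1 - linOp β) (linOp α⁻¹ (α 0))) + (1 - linOp c) (β 0) := by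
    rw [apply_eq_linOp_add c, apply_eq_linOp_add β (α 0), apply_eq_linOp_add α (β 0), map_add,
      h2] at h1
    simp only [sub_apply, one_apply_eq_self, map_sub, h3]
    rw [← sub_eq_iff_eq_add'] at h1
    generalize linOp α (linOp β (linOp α⁻¹ (α 0))) = y at *
    rw [← h1]
    abel
  rw [h4]
  calc _ ≤ ‖linOp α ((1 - linOp β) (linOp α⁻¹ (α 0)))‖ + ‖(1 - linOp c) (β 0)‖ := norm_add_le _ _
    _ ≤ ‖1 - linOp β‖ * ‖α 0‖ + ‖1 - linOp c‖ * ‖β 0‖ := by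
        refine add_le_add ?_ (ContinuousLinearMap.le_opNorm _ _)
        rw [norm_linOp_apply]
        refine (ContinuousLinearMap.le_opNorm _ _).trans_eq ?_
        rw [norm_linOp_apply]
    _ ≤ ‖linOp β - 1‖ * ‖α 0‖ + ‖linOp β - 1‖ * ‖β 0‖ := by
        rw [norm_sub_rev 1 (linOp β), norm_sub_rev 1 (linOp c)]
        gcongr
    _ = _ := by ring

/-- The heart of Bieberbach's theorem, after P. Buser: an element of `Γ` with linear part near the
identity is a translation. Among the counterexamples choose `α` moving the origin least, and then
among the elements `β` with very small rotation moving the origin mainly in the directions which `α`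
rotates most, again the one moving the origin least; the commutator of both contradicts the choice
of `β`. -/
theorem IsBieberbach.linOp_eq_one (hΓ : IsBieberbach Γ) {α : Isom n} (hα : α ∈ Γ)
    (h : ‖linOp α - 1‖ ≤ 1 / 2) : linOp α = 1 := by
  by_contra hne
  obtain ⟨α, hα, ⟨hα2, hα1⟩, hαmin⟩ := hΓ.exists_minimal
    (P := fun α => ‖linOp α - 1‖ ≤ 1 / 2 ∧ linOp α ≠ 1) ⟨α, hα, h, hne⟩
  set T := linOp α - 1 with hT
  obtain ⟨P, m', hm0, hmT, hP, hP', hPT, hTP, hTP', u, hu, hPu⟩ :=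
    exists_maximal_rotation_space (linPart n α) T (fun x => rfl) (sub_ne_zero.mpr hα1)
  obtain ⟨β₀, hβ₀, h₀1, h₀2, h₀3⟩ := hΓ.exists_near_direction hu (ε := (‖T‖ - m') / 8) (δ := 1 / 4)
    (by linarith) (by norm_num)
  have hβ₀P : ‖β₀ 0 - P (β₀ 0)‖ < ‖P (β₀ 0)‖ := by
    have e1 : β₀ 0 - P (β₀ 0) = (β₀ 0 - ‖β₀ 0‖ • u) - P (β₀ 0 - ‖β₀ 0‖ • u) := by
      rw [map_sub, map_smul, hPu]; abel
    have e2 : ‖β₀ 0 - P (β₀ 0)‖ ≤ 1 / 4 * ‖β₀ 0‖ := by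
      rw [e1]
      exact (hP' _).trans h₀3
    have e3 : ‖β₀ 0‖ ≤ ‖P (β₀ 0)‖ + ‖β₀ 0 - P (β₀ 0)‖ := by
      simpa using norm_add_le (P (β₀ 0)) (β₀ 0 - P (β₀ 0))
    have e4 : 0 < ‖β₀ 0‖ := norm_pos_iff.mpr h₀2
    linarith
  obtain ⟨β, hβ, ⟨hβ1, hβP⟩, hβmin⟩ := hΓ.exists_minimal
    (P := fun β => ‖linOp β - 1‖ ≤ (‖T‖ - m') / 8 ∧ ‖β 0 - P (β 0)‖ < ‖P (β 0)‖)
    ⟨β₀, hβ₀, h₀1, hβ₀P⟩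
  have hb0 : 0 < ‖β 0‖ := (((norm_nonneg _).trans_lt hβP).trans_le (hP _))
  set c := α * β * α⁻¹ * β⁻¹ with hc
  have hcΓ : c ∈ Γ := Γ.mul_mem (Γ.mul_mem (Γ.mul_mem hα hβ) (Γ.inv_mem hα)) (Γ.inv_mem hβ)
  set r := c 0 - T (β 0) with hr
  have hrle : ‖r‖ ≤ ‖linOp β - 1‖ * (2 * ‖β 0‖) := by
    refine (commutator_apply_zero α β hα2).trans ?_
    -- a translation `β` makes the error vanish; otherwise the minimality of `α` applies to `β`
    by_cases hB : linOp β = 1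
    · rw [hB, sub_self, norm_zero, zero_mul, zero_mul]
    · have := hαmin β hβ ⟨by linarith, hB⟩
      gcongr
      linarith
  have hr' : ‖r‖ ≤ (‖T‖ - m') / 4 * ‖β 0‖ := by
    refine hrle.trans ?_
    nlinarith
  have hb : ‖β 0‖ ≤ ‖P (β 0)‖ + ‖β 0 - P (β 0)‖ := by
    simpa using norm_add_le (P (β 0)) (β 0 - P (β 0))
  have hc0 : c 0 = T (β 0) + r := by rw [hr]; abel
  -- the component in the space of maximal rotation is scaled by `‖T‖`, the other one by at most
  -- `m'`, and the gap between the two absorbs the error `r`; so `c` competes with `β`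
  have hPc : ‖T‖ * ‖P (β 0)‖ - ‖r‖ ≤ ‖P (c 0)‖ := by
    rw [hc0, map_add, hPT, ← hTP]
    have := norm_sub_norm_le (T (P (β 0))) (-(P r))
    rw [sub_neg_eq_add, norm_neg] at this
    linarith [hP r]
  have hPc' : ‖c 0 - P (c 0)‖ ≤ m' * ‖β 0 - P (β 0)‖ + ‖r‖ := by
    have e : c 0 - P (c 0) = T (β 0 - P (β 0)) + (r - P r) := by
      rw [hc0, map_add P, hPT, map_sub T]; abel
    rw [e]
    exact (norm_add_le _ _).trans (add_le_add (hTP' _) (hP' r))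
  have hlt : ‖c 0‖ < ‖β 0‖ := by
    have e1 : ‖c 0‖ ≤ ‖T‖ * ‖β 0‖ + ‖r‖ := by
      rw [hc0]
      exact (norm_add_le _ _).trans (add_le_add (T.le_opNorm _) le_rfl)
    nlinarith
  refine absurd (hβmin c hcΓ ⟨?_, ?_⟩) (not_le.mpr hlt)
  · refine (norm_commutator_sub_one_le α β).trans ?_
    nlinarith [norm_nonneg (linOp β - 1)]
  · refine hPc'.trans_lt (lt_of_lt_of_le ?_ hPc)
    nlinarith

theorem IsBieberbach.finite_pointGroup (hΓ : IsBieberbach Γ) : Finite (pointGroup Γ) := by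
  have hfin : (linOp '' (Γ : Set (Isom n))).Finite := by
    refine finite_of_separated (ε := 1 / 2) ?_ (by norm_num) ?_
    · refine (Metric.isBounded_closedBall (x := (0 : E n →L[ℝ] E n)) (r := 1)).subset ?_
      rintro _ ⟨γ, -, rfl⟩
      exact mem_closedBall_zero_iff.mpr (norm_linOp_le γ)
    · rintro _ ⟨γ, hγ, rfl⟩ _ ⟨δ, hδ, rfl⟩ h
      rw [dist_eq_norm, ← norm_linOp_mul_inv_sub_one] at h
      have h1 := hΓ.linOp_eq_one (Γ.mul_mem hγ (Γ.inv_mem hδ)) h.le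
      calc linOp γ = linOp (γ * δ⁻¹) * linOp δ := by rw [← linOp_mul, inv_mul_cancel_right]
        _ = linOp δ := by rw [h1, one_mul]
  have := hfin.to_subtype
  refine Finite.of_injective (β := linOp '' (Γ : Set (Isom n)))
    (fun B => ⟨(B.1.toContinuousLinearEquiv : E n →L[ℝ] E n), ?_⟩) ?_
  · obtain ⟨γ, hγ, h⟩ := Subgroup.mem_map.mp B.2
    exact ⟨γ, hγ, by rw [← h]; rfl⟩
  · intro B C h
    ext1
    ext1 x
    exact congrArg (fun T : E n →L[ℝ] E n => T x) (congrArg Subtype.val h)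

theorem transLattice_apply {t : E n} (ht : t ∈ transLattice Γ) :
    ∃ γ ∈ Γ, linOp γ = 1 ∧ γ 0 = t := by
  refine ⟨_, ht, ?_, ?_⟩
  · ext1 x
    rfl
  · simp

theorem mem_transLattice {γ : Isom n} (hγ : γ ∈ Γ) (h : linOp γ = 1) : γ 0 ∈ transLattice Γ := by
  change AffineIsometryEquiv.constVAdd ℝ (E n) (γ 0) ∈ Γ
  convert hγ
  ext1 x
  rw [AffineIsometryEquiv.coe_constVAdd, apply_eq_linOp_add γ x, h, one_apply_eq_self,
    add_comm]
  rfl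

/-- The translation lattice as a `ℤ`-submodule. -/
def transSubmodule (Γ : Subgroup (Isom n)) : Submodule ℤ (E n) :=
  AddSubgroup.toIntSubmodule
    { carrier := transLattice Γ
      zero_mem' := mem_transLattice Γ.one_mem linOp_one
      add_mem' := by
        intro s t hs ht
        obtain ⟨γ, hγ, hγ1, rfl⟩ := transLattice_apply hs
        obtain ⟨δ, hδ, hδ1, rfl⟩ := transLattice_apply ht
        have := mem_transLattice (Γ.mul_mem hγ hδ) (by rw [linOp_mul, hγ1, hδ1, one_mul])
        rwa [isom_mul_apply, apply_eq_linOp_add, hγ1, one_apply_eq_self,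
          add_comm] at this
      neg_mem' := by
        intro t ht
        obtain ⟨γ, hγ, hγ1, rfl⟩ := transLattice_apply ht
        have h1 : linOp γ⁻¹ = 1 := by rw [← linOp_inv_mul γ, hγ1, mul_one]
        have := mem_transLattice (Γ.inv_mem hγ) h1
        have h2 := isom_inv_apply_self γ 0
        rw [apply_eq_linOp_add, h1, one_apply_eq_self] at h2
        rwa [← eq_neg_of_add_eq_zero_right h2] }

theorem IsBieberbach.discreteTopology_transSubmodule (hΓ : IsBieberbach Γ) :
    DiscreteTopology (transSubmodule Γ) := by
  obtain ⟨ε, hε, h⟩ := hΓ.exists_separation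
  refine discreteTopology_of_isOpen_singleton_zero ?_
  rw [Metric.isOpen_singleton_iff]
  refine ⟨ε, hε, fun t ht => ?_⟩
  obtain ⟨γ, hγ, hγ1, hγt⟩ := transLattice_apply t.2
  rw [dist_zero_right] at ht
  have := h γ hγ (by rwa [hγ1, sub_self, norm_zero]) (by rw [hγt]; exact ht)
  rw [this] at hγt
  exact Subtype.ext hγt.symm

/-- Every point is at bounded distance from the translation lattice, as `Λ` has finite index
in `Γ`. -/
theorem IsBieberbach.exists_trans_near (hΓ : IsBieberbach Γ) :
    ∃ D : ℝ, ∀ x : E n, ∃ t ∈ transLattice Γ, ‖x - t‖ ≤ D := by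
  obtain ⟨D, hD⟩ := hΓ.exists_orbit_near
  have hfin := hΓ.finite_pointGroup
  have hex : ∀ B : pointGroup Γ, ∃ δ ∈ Γ, linPart n δ = B := fun B => Subgroup.mem_map.mp B.2
  choose δ hδ hδB using hex
  obtain ⟨M, hM⟩ := (Set.finite_range fun B => ‖δ B 0‖).bddAbove
  refine ⟨D + M, fun x => ?_⟩
  obtain ⟨γ, hγ, hγx⟩ := hD x
  let B : pointGroup Γ := ⟨linPart n γ, Subgroup.mem_map_of_mem _ hγ⟩
  have h1 : linOp (γ * (δ B)⁻¹) = 1 := by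
    have h2 : linOp γ = linOp (δ B) := by
      ext1 x
      rw [linOp_apply, linOp_apply, hδB]
    rw [linOp_mul, h2, linOp_mul_inv]
  refine ⟨(γ * (δ B)⁻¹) 0, mem_transLattice (Γ.mul_mem hγ (Γ.inv_mem (hδ B))) h1, ?_⟩
  calc ‖x - (γ * (δ B)⁻¹) 0‖ = ‖(x - γ 0) + (γ 0 - γ ((δ B)⁻¹ 0))‖ := by
        rw [isom_mul_apply]; congr 1; abel
    _ ≤ ‖x - γ 0‖ + ‖γ 0 - γ ((δ B)⁻¹ 0)‖ := norm_add_le _ _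
    _ ≤ D + M := by
        refine add_le_add (by rwa [norm_sub_rev]) ?_
        rw [isom_norm_sub, zero_sub, norm_neg, norm_inv_apply_zero]
        exact hM ⟨B, rfl⟩

theorem IsBieberbach.span_transLattice (hΓ : IsBieberbach Γ) :
    Submodule.span ℝ (transLattice Γ) = ⊤ := by
  set W := Submodule.span ℝ (transLattice Γ) with hW
  rw [← Submodule.orthogonal_eq_bot_iff, Submodule.eq_bot_iff]
  intro u hu
  by_contra hu0
  obtain ⟨D, hD⟩ := hΓ.exists_trans_near
  have hu0' : 0 < ‖u‖ := norm_pos_iff.mpr hu0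
  -- the multiple of `u` of norm `|D| + 1` is too far from the span of `Λ`
  obtain ⟨t, ht, hxt⟩ := hD (((|D| + 1) / ‖u‖) • u)
  have h1 : inner ℝ u t = 0 := Submodule.inner_left_of_mem_orthogonal (Submodule.subset_span ht) hu
  have h2 : inner ℝ u (((|D| + 1) / ‖u‖) • u - t) = (|D| + 1) * ‖u‖ := by
    rw [inner_sub_right, h1, inner_smul_right, real_inner_self_eq_norm_sq]
    field_simp
    ring
  have h3 := real_inner_le_norm u (((|D| + 1) / ‖u‖) • u - t)
  rw [h2] at h3
  have h4 : |D| + 1 ≤ D := by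
    refine le_of_mul_le_mul_right (h3.trans ?_) hu0'
    rw [mul_comm]
    gcongr
  linarith [le_abs_self D]

theorem IsBieberbach.exists_basis (hΓ : IsBieberbach Γ) :
    ∃ b : Module.Basis (Fin n) ℝ (E n),
      ∀ t, t ∈ transLattice Γ ↔ t ∈ Submodule.span ℤ (Set.range b) := by
  have := hΓ.discreteTopology_transSubmodule
  have : IsZLattice ℝ (transSubmodule Γ) := ⟨hΓ.span_transLattice⟩
  have hr : Module.finrank ℤ (transSubmodule Γ) = n := by
    rw [ZLattice.rank ℝ, finrank_euclideanSpace_fin]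
  have := ZLattice.module_free ℝ (transSubmodule Γ)
  have := ZLattice.module_finite ℝ (transSubmodule Γ)
  let b := Module.finBasisOfFinrankEq ℤ (transSubmodule Γ) hr
  refine ⟨b.ofZLatticeBasis ℝ, fun t => ?_⟩
  rw [Module.Basis.ofZLatticeBasis_span]
  rfl

end bieberbach

/-! ### The Hodge Laplacian of Euclidean space -/

/-- The sum of the pure second partial derivatives of a vector valued function. -/
noncomputable def sndDerivTrace {n : ℕ} {F : Type*} [NormedAddCommGroup F] [NormedSpace ℝ F]
    (f : E n → F) (x : E n) : F :=
  ∑ i : Fin n, fderiv ℝ (fderiv ℝ f) x (EuclideanSpace.basisFun (Fin n) ℝ i)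
    (EuclideanSpace.basisFun (Fin n) ℝ i)

section laplacian

variable {n p : ℕ}

theorem differentiableAt_fderiv {F : Type*} [NormedAddCommGroup F] [NormedSpace ℝ F]
    {f : E n → F} {x : E n} (h : ContDiffAt ℝ ∞ f x) : DifferentiableAt ℝ (fderiv ℝ f) x :=
  (h.fderiv_right (m := ∞) le_rfl).differentiableAt (by simp)

theorem fderiv_extDeriv_apply {α : E n → Alt n p} {x : E n} (h : ContDiffAt ℝ ∞ α x) (w : E n) :
    fderiv ℝ (extDeriv α) x w = .alternatizeUncurryFin (fderiv ℝ (fderiv ℝ α) x w) := by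
  let L : (E n →L[ℝ] Alt n p) →L[ℝ] Alt n (p + 1) :=
    ContinuousAlternatingMap.alternatizeUncurryFinCLM ℝ (E n) ℂ
  have h1 : HasFDerivAt (extDeriv α) (L.comp (fderiv ℝ (fderiv ℝ α) x)) x :=
    (L.hasFDerivAt (x := fderiv ℝ α x)).comp x (differentiableAt_fderiv h).hasFDerivAt
  rw [h1.fderiv]
  rfl

theorem fderiv_codiff_apply {α : E n → Alt n (p + 1)} {x : E n} (h : ContDiffAt ℝ ∞ α x)
    (w : E n) : fderiv ℝ (codiff α) x w =
      - ∑ i : Fin n, (fderiv ℝ (fderiv ℝ α) x w (EuclideanSpace.basisFun (Fin n) ℝ i)).curryLeft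
        (EuclideanSpace.basisFun (Fin n) ℝ i) := by
  let L (i : Fin n) : (E n →L[ℝ] Alt n (p + 1)) →L[ℝ] Alt n p :=
    ((ContinuousLinearMap.apply ℝ (Alt n p) (EuclideanSpace.basisFun (Fin n) ℝ i)).comp
      (ContinuousAlternatingMap.curryLeftLI (𝕜 := ℝ) (E := E n) (F := ℂ)
        (n := p)).toContinuousLinearMap).comp
      (ContinuousLinearMap.apply ℝ (Alt n (p + 1)) (EuclideanSpace.basisFun (Fin n) ℝ i))
  have hL : codiff α = fun y => -(∑ i : Fin n, L i) (fderiv ℝ α y) := by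
    funext y
    rw [sum_apply]
    rfl
  have h1 : HasFDerivAt (codiff α) (-((∑ i : Fin n, L i).comp (fderiv ℝ (fderiv ℝ α) x))) x := by
    rw [hL]
    exact (((∑ i : Fin n, L i).hasFDerivAt (x := fderiv ℝ α x)).comp x
      (differentiableAt_fderiv h).hasFDerivAt).neg
  rw [h1.fderiv, neg_apply, ContinuousLinearMap.comp_apply, sum_apply]
  rfl

theorem codiff_extDeriv_apply {α : E n → Alt n p} {x : E n} (h : ContDiffAt ℝ ∞ α x)
    (v : Fin p → E n) : codiff (extDeriv α) x v =
      - ∑ i : Fin n, ∑ j : Fin (p + 1), (-1) ^ (j : ℕ) •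
        fderiv ℝ (fderiv ℝ α) x (EuclideanSpace.basisFun (Fin n) ℝ i)
          ((Matrix.vecCons (EuclideanSpace.basisFun (Fin n) ℝ i) v : Fin (p + 1) → E n) j)
          (j.removeNth (Matrix.vecCons (EuclideanSpace.basisFun (Fin n) ℝ i) v)) := by
  simp only [codiff, fderiv_extDeriv_apply h, ContinuousAlternatingMap.neg_apply,
    ContinuousAlternatingMap.sum_apply, ContinuousAlternatingMap.curryLeft_apply_apply,
    ContinuousAlternatingMap.alternatizeUncurryFin_apply]

theorem _root_.Fin.removeNth_zero_vecCons {X : Type*} {k : ℕ} (a : X) (v : Fin k → X) :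
    (0 : Fin (k + 1)).removeNth (Matrix.vecCons a v) = v :=
  funext fun _ => rfl

theorem _root_.Fin.removeNth_succ_vecCons {X : Type*} {k : ℕ} (a : X) (v : Fin (k + 1) → X)
    (j : Fin (k + 1)) :
    j.succ.removeNth (Matrix.vecCons a v) = Matrix.vecCons a (j.removeNth v) := by
  funext i
  refine Fin.cases rfl (fun i => ?_) i
  simp [Fin.removeNth]

/-- On flat space the Hodge Laplacian is the negative of the sum of the second partial derivatives,
coefficient by coefficient: the mixed terms in `dδ` and `δd` cancel by the symmetry of second
derivatives. -/
theorem hodgeLaplacian_eq : (p : ℕ) → {α : E n → Alt n p} → {x : E n} → ContDiffAt ℝ ∞ α x →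
    hodgeLaplacian p α x = - sndDerivTrace α x
  | 0, α, x, h => by
    ext v
    simp only [hodgeLaplacian]
    rw [codiff_extDeriv_apply h]
    simp only [sndDerivTrace,
      ContinuousAlternatingMap.neg_apply, ContinuousAlternatingMap.sum_apply]
    congr 1
    refine Finset.sum_congr rfl fun i _ => ?_
    rw [Fin.sum_univ_succ, Fin.sum_univ_zero, add_zero, Fin.val_zero, pow_zero, one_smul,
      Fin.removeNth_zero_vecCons, Matrix.cons_val_zero]
  | p + 1, α, x, h => by
    have hsymm : IsSymmSndFDerivAt ℝ α x := h.isSymmSndFDerivAt (by simp; norm_cast)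
    ext v
    simp only [hodgeLaplacian, Pi.add_apply, ContinuousAlternatingMap.add_apply]
    rw [codiff_extDeriv_apply h, extDeriv, ContinuousAlternatingMap.alternatizeUncurryFin_apply]
    simp only [fderiv_codiff_apply h, ContinuousAlternatingMap.neg_apply,
      ContinuousAlternatingMap.sum_apply, ContinuousAlternatingMap.curryLeft_apply_apply,
      sndDerivTrace, smul_neg, Finset.sum_neg_distrib]
    rw [← neg_add, neg_inj]
    simp only [Finset.smul_sum]
    rw [Finset.sum_comm, ← Finset.sum_add_distrib]
    refine Finset.sum_congr rfl fun i _ => ?_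
    rw [Fin.sum_univ_succ (n := p + 1), add_left_comm, ← Finset.sum_add_distrib]
    rw [Finset.sum_eq_zero, add_zero, Fin.val_zero, pow_zero, one_smul,
      Fin.removeNth_zero_vecCons, Matrix.cons_val_zero]
    intro j _
    rw [hsymm.eq, Fin.removeNth_succ_vecCons, Matrix.cons_val_succ, Fin.val_succ, pow_succ, mul_neg,
      mul_one, neg_smul, add_neg_cancel]

end laplacian

/-! ### Eigenforms on the quotient and invariant eigenforms on Euclidean space -/

section charts

variable {n p : ℕ} {Γ : Subgroup (Isom n)}

/-- A point stabilizer is finite by discreteness, hence trivial in a torsion-free group. -/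
theorem IsBieberbach.eq_one_of_apply_eq (hΓ : IsBieberbach Γ) {γ : Isom n} (hγ : γ ∈ Γ) {x : E n}
    (h : γ x = x) : γ = 1 := by
  by_contra hne
  refine hΓ.torsionFree γ hγ hne (finite_powers.mp ?_)
  refine (hΓ.finite_norm_le (2 * ‖x‖)).subset ?_
  rintro _ ⟨k, rfl⟩
  have hk : ∀ k : ℕ, (γ ^ k) x = x := by
    intro k
    induction k with
    | zero => rfl
    | succ k ih => rw [pow_succ, isom_mul_apply, h, ih]
  refine ⟨Γ.pow_mem hγ k, ?_⟩
  calc ‖(γ ^ k) 0‖ = ‖((γ ^ k) 0 - (γ ^ k) x) + x‖ := by rw [hk, sub_add_cancel]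
    _ ≤ ‖(γ ^ k) 0 - (γ ^ k) x‖ + ‖x‖ := norm_add_le _ _
    _ = 2 * ‖x‖ := by rw [isom_norm_sub, zero_sub, norm_neg]; ring

theorem IsBieberbach.eq_of_apply_eq (hΓ : IsBieberbach Γ) {γ δ : Isom n} (hγ : γ ∈ Γ) (hδ : δ ∈ Γ)
    {x : E n} (h : γ x = δ x) : γ = δ := by
  have h1 := hΓ.eq_one_of_apply_eq (Γ.mul_mem (Γ.inv_mem hδ) hγ) (x := x)
    (by rw [isom_mul_apply, h, isom_inv_apply_self])
  exact (inv_mul_eq_one.mp h1).symm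

/-- The action of a Bieberbach group is properly discontinuous and free. -/
theorem IsBieberbach.exists_ball (hΓ : IsBieberbach Γ) (x : E n) :
    ∃ ρ > 0, ∀ δ ∈ Γ, ∀ y ∈ Metric.ball x ρ, δ y ∈ Metric.ball x ρ → δ = 1 := by
  have hfin : {γ : Isom n | (γ ∈ Γ ∧ ‖γ 0‖ ≤ 1 + 2 * ‖x‖) ∧ γ ≠ 1}.Finite :=
    (hΓ.finite_norm_le _).subset fun _ h => h.1
  obtain ⟨r, hr0, hr⟩ : ∃ r > 0, ∀ γ ∈ {γ : Isom n | (γ ∈ Γ ∧ ‖γ 0‖ ≤ 1 + 2 * ‖x‖) ∧ γ ≠ 1},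
      r ≤ ‖γ x - x‖ := by
    rcases {γ : Isom n | (γ ∈ Γ ∧ ‖γ 0‖ ≤ 1 + 2 * ‖x‖) ∧ γ ≠ 1}.eq_empty_or_nonempty with h | h
    · exact ⟨1, one_pos, by simp [h]⟩
    · obtain ⟨γ, hγ, hmin⟩ := Set.exists_min_image _ (fun γ : Isom n => ‖γ x - x‖) hfin h
      refine ⟨‖γ x - x‖, norm_pos_iff.mpr fun h0 => hγ.2 ?_, hmin⟩
      exact hΓ.eq_one_of_apply_eq hγ.1.1 (sub_eq_zero.mp h0)
  refine ⟨min r 1 / 2, by positivity, fun δ hδ y hy hy' => ?_⟩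
  by_contra hne
  rw [mem_ball_iff_norm] at hy hy'
  have h1 : ‖δ x - x‖ < min r 1 := by
    calc ‖δ x - x‖ = ‖(δ x - δ y) + (δ y - x)‖ := by congr 1; abel
      _ ≤ ‖δ x - δ y‖ + ‖δ y - x‖ := norm_add_le _ _
      _ < min r 1 / 2 + min r 1 / 2 := by
          refine add_lt_add ?_ hy'
          rwa [isom_norm_sub, norm_sub_rev]
      _ = min r 1 := add_halves _
  refine absurd (hr δ ⟨⟨hδ, ?_⟩, hne⟩) (not_le.mpr (h1.trans_le (min_le_left _ _)))
  calc ‖δ 0‖ = ‖(δ 0 - δ x) + (δ x - x) + x‖ := by congr 1; abel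
    _ ≤ ‖δ 0 - δ x‖ + ‖δ x - x‖ + ‖x‖ := norm_add₃_le
    _ ≤ ‖x‖ + 1 + ‖x‖ := by
        gcongr
        · rw [isom_norm_sub, zero_sub, norm_neg]
        · exact h1.le.trans (min_le_right _ _)
    _ = _ := by ring

theorem IsBieberbach.exists_chart (hΓ : IsBieberbach Γ) (x : E n) :
    ∃ φ : flatAtlas Γ, x ∈ φ.1.target := by
  obtain ⟨ρ, hρ, h⟩ := hΓ.exists_ball x
  have hinj : Set.InjOn (proj Γ) (Metric.ball x ρ) := by
    intro y hy z hz hyz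
    obtain ⟨γ, hγ, rfl⟩ := Quotient.exact hyz
    rw [h γ hγ y hy hz]
    rfl
  let e : OpenPartialHomeomorph (E n) (FlatMfd Γ) :=
    OpenPartialHomeomorph.ofContinuousOpen (hinj.toPartialEquiv (proj Γ) (Metric.ball x ρ))
      continuous_proj.continuousOn isOpenMap_proj Metric.isOpen_ball
  exact ⟨⟨e.symm, fun y _ => rfl⟩, Metric.mem_ball_self hρ⟩

theorem proj_apply {γ : Isom n} (hγ : γ ∈ Γ) (x : E n) : proj Γ (γ x) = proj Γ x :=
  (Quotient.sound ⟨γ, hγ, rfl⟩ : proj Γ x = proj Γ (γ x)).symm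

/-- The changes of charts are locally given by elements of the group. -/
theorem IsBieberbach.exists_transition (hΓ : IsBieberbach Γ) (φ ψ : flatAtlas Γ) {x : E n}
    (hx : x ∈ φ.1.target) (hx' : φ.1.symm x ∈ ψ.1.source) :
    ∃ γ ∈ Γ, (fun y => ψ.1 (φ.1.symm y)) =ᶠ[nhds x] γ := by
  set g : E n → E n := fun y => ψ.1 (φ.1.symm y) with hg
  have hgc : ContinuousAt g x :=
    (ψ.1.continuousAt hx').comp (φ.1.continuousAt_symm hx)
  have hdom : ∀ᶠ z in nhds x, z ∈ φ.1.target ∧ φ.1.symm z ∈ ψ.1.source :=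
    (φ.1.open_target.eventually_mem hx).and
      ((φ.1.continuousAt_symm hx).eventually (ψ.1.open_source.eventually_mem hx'))
  have hlift : ∀ z, z ∈ φ.1.target ∧ φ.1.symm z ∈ ψ.1.source → ∃ γ ∈ Γ, γ z = g z := by
    rintro z ⟨hz, hz'⟩
    have h1 : proj Γ z = proj Γ (g z) := by
      rw [← ψ.2 _ (ψ.1.map_source hz'), ψ.1.left_inv hz', φ.2 z hz]
    exact Quotient.exact h1
  obtain ⟨γ, hγ, hγx⟩ := hlift x ⟨hx, hx'⟩
  refine ⟨γ, hγ, ?_⟩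
  obtain ⟨ρ, hρ, hball⟩ := hΓ.exists_ball x
  have hnear : ∀ᶠ z in nhds x, γ⁻¹ (g z) ∈ Metric.ball x ρ := by
    have hc : ContinuousAt (fun z => γ⁻¹ (g z)) x :=
      (γ⁻¹ : Isom n).continuous.continuousAt.comp hgc
    refine hc.eventually (Metric.isOpen_ball.eventually_mem ?_)
    change γ⁻¹ (g x) ∈ _
    rw [← hγx, isom_inv_apply_self]
    exact Metric.mem_ball_self hρ
  filter_upwards [hdom, hnear, Metric.ball_mem_nhds x hρ] with z hz hz1 hz2
  obtain ⟨δ, hδ, hδz⟩ := hlift z hz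
  rw [← hδz, ← isom_mul_apply] at hz1
  have h1 := hball _ (Γ.mul_mem (Γ.inv_mem hγ) hδ) z hz2 hz1
  rw [← hδz, inv_mul_eq_one.mp h1]

theorem fderiv_isom (γ : Isom n) (x : E n) : fderiv ℝ γ x = linOp γ := by
  have h : (γ : E n → E n) = fun y => linOp γ y + γ 0 := funext (apply_eq_linOp_add γ)
  rw [h, fderiv_add_const]
  exact (linOp γ).fderiv

/-- The local expressions of a form on `M_Γ` are related by the pull-back under any element of `Γ`
which maps a point of one chart to a point of the other. -/
theorem IsBieberbach.forms_pullback (hΓ : IsBieberbach Γ) (α : forms Γ p) (φ ψ : flatAtlas Γ)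
    {γ : Isom n} (hγ : γ ∈ Γ) {x : E n} (hx : x ∈ φ.1.target) (hx' : γ x ∈ ψ.1.target) :
    α.1 φ x = (α.1 ψ (γ x)).compContinuousLinearMap (linOp γ) := by
  have h1 : φ.1.symm x = ψ.1.symm (γ x) := by
    rw [φ.2 x hx, ψ.2 _ hx', proj_apply hγ]
  have h2 : φ.1.symm x ∈ ψ.1.source := by
    rw [h1]
    exact ψ.1.map_target hx'
  have h3 : ψ.1 (φ.1.symm x) = γ x := by rw [h1, ψ.1.right_inv hx']
  obtain ⟨δ, hδ, hδx⟩ := hΓ.exists_transition φ ψ hx h2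
  have h4 : δ = γ := hΓ.eq_of_apply_eq hδ hγ (x := x) (hδx.self_of_nhds.symm.trans h3)
  rw [α.2.2.2 φ ψ x hx h2, h3, hδx.fderiv_eq, fderiv_isom, h4]

theorem sndDerivTrace_congr {F : Type*} [NormedAddCommGroup F] [NormedSpace ℝ F] {f g : E n → F}
    {x : E n} (h : f =ᶠ[nhds x] g) : sndDerivTrace f x = sndDerivTrace g x := by
  unfold sndDerivTrace
  rw [h.fderiv.fderiv_eq]

theorem hodgeLaplacian_congr {α β : E n → Alt n p} {x : E n} (hα : ContDiffAt ℝ ∞ α x)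
    (h : α =ᶠ[nhds x] β) : hodgeLaplacian p α x = hodgeLaplacian p β x := by
  rw [hodgeLaplacian_eq p hα, hodgeLaplacian_eq p (hα.congr_of_eventuallyEq h.symm),
    sndDerivTrace_congr h]

/-- The `Γ`-invariant smooth `p`-forms on `ℝⁿ` which satisfy `(dδ + δd) θ = ν θ`. -/
noncomputable def invariantEigenforms (Γ : Subgroup (Isom n)) (p : ℕ) (ν : ℝ) :
    Submodule ℂ (E n → Alt n p) where
  carrier := {θ | ContDiff ℝ ∞ θ ∧
    (∀ γ ∈ Γ, ∀ x, θ x = (θ (γ x)).compContinuousLinearMap (linOp γ)) ∧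
    ∀ x, hodgeLaplacian p θ x = (ν : ℂ) • θ x}
  zero_mem' := by
    refine ⟨contDiff_const, fun γ _ x => ?_, fun x => ?_⟩
    · ext v
      simp
    · have h : (0 : E n → Alt n p) = fun _ => 0 := rfl
      rw [h, hodgeLaplacian_eq p contDiffAt_const]
      ext v
      simp [sndDerivTrace]
  add_mem' := by
    rintro α β ⟨h1, h2, h3⟩ ⟨k1, k2, k3⟩
    refine ⟨h1.add k1, fun γ hγ x => ?_, fun x => ?_⟩
    · ext v
      simp [h2 γ hγ x, k2 γ hγ x]
    · rw [hodgeLaplacian_add p h1.contDiffAt k1.contDiffAt, h3, k3, Pi.add_apply, smul_add]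
  smul_mem' := by
    rintro c α ⟨h1, h2, h3⟩
    refine ⟨h1.const_smul c, fun γ hγ x => ?_, fun x => ?_⟩
    · ext v
      simp [h2 γ hγ x]
    · rw [hodgeLaplacian_smul c p h1.contDiffAt, h3, Pi.smul_apply, smul_comm]

open Classical in
theorem restrict_mem_forms (hΓ : IsBieberbach Γ) {ν : ℝ} (θ : invariantEigenforms Γ p ν) :
    (fun (φ : flatAtlas Γ) (x : E n) => if x ∈ φ.1.target then θ.1 x else 0) ∈ forms Γ p := by
  refine ⟨fun φ => ?_, fun φ x hx => if_neg hx, fun φ ψ x hx hx' => ?_⟩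
  · exact θ.2.1.contDiffOn.congr fun x hx => if_pos hx
  · obtain ⟨γ, hγ, hγx⟩ := hΓ.exists_transition φ ψ hx hx'
    have h1 : ψ.1 (φ.1.symm x) = γ x := hγx.self_of_nhds
    simp only
    rw [if_pos hx, if_pos (ψ.1.map_source hx'), hγx.fderiv_eq, fderiv_isom, h1]
    exact θ.2.2.1 γ hγ x

open Classical in
/-- Restriction of an invariant eigenform on `ℝⁿ` to the charts of `M_Γ`. -/
noncomputable def restrictToCharts (hΓ : IsBieberbach Γ) (ν : ℝ) :
    invariantEigenforms Γ p ν →ₗ[ℂ] eigenspace Γ p ν where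
  toFun θ := ⟨⟨_, restrict_mem_forms hΓ θ⟩, fun φ x hx => by
    have h : (fun x : E n => if x ∈ φ.1.target then θ.1 x else 0) =ᶠ[nhds x] θ.1 := by
      filter_upwards [φ.1.open_target.mem_nhds hx] with y hy
      exact if_pos hy
    have h1 := hodgeLaplacian_congr θ.2.1.contDiffAt h.symm
    refine h1.symm.trans ((θ.2.2.2 x).trans ?_)
    simp only
    rw [if_pos hx]⟩
  map_add' θ η := by
    ext φ x v
    by_cases hx : x ∈ φ.1.target <;> simp [hx]
  map_smul' c θ := by
    ext φ x v
    by_cases hx : x ∈ φ.1.target <;> simp [hx]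

theorem restrictToCharts_apply (hΓ : IsBieberbach Γ) (ν : ℝ) (θ : invariantEigenforms Γ p ν)
    {φ : flatAtlas Γ} {x : E n} (hx : x ∈ φ.1.target) :
    (restrictToCharts hΓ ν θ).1.1 φ x = θ.1 x := if_pos hx

theorem restrictToCharts_bijective (hΓ : IsBieberbach Γ) (ν : ℝ) :
    Function.Bijective (restrictToCharts (p := p) hΓ ν) := by
  constructor
  · intro θ η h
    ext1
    funext x
    obtain ⟨φ, hx⟩ := hΓ.exists_chart x
    rw [← restrictToCharts_apply hΓ ν θ hx, h, restrictToCharts_apply hΓ ν η hx]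
  · intro α
    choose c hc using hΓ.exists_chart
    let θ : E n → Alt n p := fun x => α.1.1 (c x) x
    have hθ : ∀ (φ : flatAtlas Γ) x, x ∈ φ.1.target → α.1.1 φ x = θ x := by
      intro φ x hx
      have h := hΓ.forms_pullback α.1 φ (c x) Γ.one_mem hx (hc x)
      rw [h]
      rfl
    have hloc : ∀ x, α.1.1 (c x) =ᶠ[nhds x] θ := fun x => by
      filter_upwards [(c x).1.open_target.mem_nhds (hc x)] with y hy
      exact hθ _ _ hy
    have hsm : ∀ x, ContDiffAt ℝ ∞ (α.1.1 (c x)) x := fun x => forms_contDiffAt α.1 (c x) (hc x)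
    refine ⟨⟨θ, ?_, fun γ hγ x => ?_, fun x => ?_⟩, ?_⟩
    · exact contDiff_iff_contDiffAt.mpr fun x => (hsm x).congr_of_eventuallyEq (hloc x).symm
    · exact hΓ.forms_pullback α.1 (c x) (c (γ x)) hγ (hc x) (hc (γ x))
    · rw [← hodgeLaplacian_congr (hsm x) (hloc x), α.2 (c x) x (hc x)]
    · ext1
      ext1
      funext φ x
      by_cases hx : x ∈ φ.1.target
      · rw [restrictToCharts_apply hΓ ν _ hx, hθ φ x hx]
      · rw [α.1.2.2.1 φ x hx]
        exact if_neg hx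

theorem IsBieberbach.multiplicity_eq (hΓ : IsBieberbach Γ) (p : ℕ) (ν : ℝ) :
    multiplicity Γ p ν = Module.rank ℂ (invariantEigenforms Γ p ν) :=
  (LinearEquiv.ofBijective _ (restrictToCharts_bijective hΓ ν)).rank_eq.symm

end charts

/-! ### Fourier analysis on the torus of the translation lattice -/

open MeasureTheory

/-- The coordinate map `ℝⁿ → (ℝ/ℤ)ⁿ` with respect to a basis; its kernel is the lattice spanned by
the basis. -/
noncomputable def toTorus {n : ℕ} (b : Module.Basis (Fin n) ℝ (E n)) (x : E n) :
    UnitAddTorus (Fin n) := fun i => (b.repr x i : UnitAddCircle)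

/-- Periodicity with respect to the lattice spanned by a basis. -/
def IsPeriodic {n : ℕ} {F : Type*} (b : Module.Basis (Fin n) ℝ (E n)) (f : E n → F) : Prop :=
  ∀ t ∈ Submodule.span ℤ (Set.range b), ∀ x, f (x + t) = f x

section torus

variable {n : ℕ} (b : Module.Basis (Fin n) ℝ (E n))

theorem toTorus_add (x y : E n) : toTorus b (x + y) = toTorus b x + toTorus b y := by
  funext i
  simp [toTorus]

theorem toTorus_eq_iff {x y : E n} :
    toTorus b x = toTorus b y ↔ x - y ∈ Submodule.span ℤ (Set.range b) := by
  rw [b.mem_span_iff_repr_mem ℤ, funext_iff]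
  refine forall_congr' fun i => ?_
  rw [toTorus, toTorus, ← sub_eq_zero, ← AddCircle.coe_sub, AddCircle.coe_eq_zero_iff]
  simp

theorem isOpenQuotientMap_toTorus : IsOpenQuotientMap (toTorus b) := by
  have h1 : IsOpenQuotientMap (fun (x : Fin n → ℝ) (i : Fin n) => (x i : UnitAddCircle)) :=
    IsOpenQuotientMap.piMap fun _ => QuotientAddGroup.isOpenQuotientMap_mk
  exact h1.comp b.equivFunL.toHomeomorph.isOpenQuotientMap

/-- The function on the torus with a given periodic pull-back to `ℝⁿ`, defined by means of a section
of the coordinate map. -/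
noncomputable def descend {F : Type*} (f : E n → F) (t : UnitAddTorus (Fin n)) : F :=
  f (Function.surjInv (isOpenQuotientMap_toTorus b).surjective t)

variable {b} {F : Type*}

theorem descend_toTorus {f : E n → F} (hf : IsPeriodic b f) (x : E n) :
    descend b f (toTorus b x) = f x := by
  set y := Function.surjInv (isOpenQuotientMap_toTorus b).surjective (toTorus b x)
  have h : toTorus b y = toTorus b x := Function.surjInv_eq _ _
  have h1 := hf _ ((toTorus_eq_iff b).mp h) x
  rw [add_sub_cancel] at h1
  exact h1

theorem continuous_descend [TopologicalSpace F] {f : E n → F} (hf : IsPeriodic b f)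
    (hc : Continuous f) : Continuous (descend b f) := by
  rw [(isOpenQuotientMap_toTorus b).isQuotientMap.continuous_iff]
  exact hc.congr fun x => (descend_toTorus hf x).symm

variable (n) in
/-- The Haar probability measure on the torus. -/
noncomputable def torusMeasure : Measure (UnitAddTorus (Fin n)) :=
  Measure.pi fun _ => AddCircle.haarAddCircle

instance : IsProbabilityMeasure (torusMeasure n) := by
  unfold torusMeasure; infer_instance

instance : (torusMeasure n).IsAddLeftInvariant := by
  unfold torusMeasure; infer_instance

instance : (torusMeasure n).IsAddRightInvariant := by
  refine ⟨fun g => ?_⟩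
  simp_rw [add_comm _ g]
  exact map_add_left_eq_self _ g

variable [NormedAddCommGroup F]

theorem integrable_torus {g : UnitAddTorus (Fin n) → F} (hg : Continuous g) :
    Integrable g (torusMeasure n) :=
  hg.integrable_of_hasCompactSupport (HasCompactSupport.of_compactSpace g)

theorem IsPeriodic.fderiv [NormedSpace ℝ F] {f : E n → F} (hf : IsPeriodic b f) :
    IsPeriodic b (fderiv ℝ f) := by
  intro t ht x
  rw [← fderiv_comp_add_right]
  congr 1
  funext y
  exact hf t ht y

/-- The integral of a directional derivative over the torus vanishes, because the integral of a
translate does not depend on the translation. -/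
theorem integral_descend_fderiv [NormedSpace ℝ F] [CompleteSpace F] {f : E n → F}
    (hf : IsPeriodic b f) (hc : ContDiff ℝ 1 f) (w : E n) :
    ∫ t, descend b (fun x => fderiv ℝ f x w) t ∂torusMeasure n = 0 := by
  have hg : IsPeriodic b (fun x => fderiv ℝ f x w) := fun t ht x =>
    congrArg (fun T : E n →L[ℝ] F => T w) (hf.fderiv t ht x)
  have hgc : Continuous (descend b (fun x => fderiv ℝ f x w)) :=
    continuous_descend hg ((hc.continuous_fderiv (by simp)).clm_apply continuous_const)
  have hfc : Continuous (descend b f) := continuous_descend hf hc.continuous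
  obtain ⟨C, hC⟩ := isCompact_univ.exists_bound_of_continuousOn hgc.continuousOn
  have key := hasDerivAt_integral_of_dominated_loc_of_deriv_le (μ := torusMeasure n)
    (F := fun (s : ℝ) t => descend b f (t + toTorus b (s • w)))
    (F' := fun (s : ℝ) t => descend b (fun x => fderiv ℝ f x w) (t + toTorus b (s • w)))
    (x₀ := 0) (s := Set.univ) (bound := fun _ => C) Filter.univ_mem
    (Filter.Eventually.of_forall fun s =>
      (hfc.comp (continuous_id.add continuous_const)).aestronglyMeasurable)
    (integrable_torus (hfc.comp (continuous_id.add continuous_const)))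
    (hgc.comp (continuous_id.add continuous_const)).aestronglyMeasurable
    (Filter.Eventually.of_forall fun t s _ => hC _ (Set.mem_univ _))
    (integrable_const C)
    (Filter.Eventually.of_forall fun t s _ => by
      obtain ⟨x, rfl⟩ := (isOpenQuotientMap_toTorus b).surjective t
      simp only [← toTorus_add, descend_toTorus hf, descend_toTorus hg]
      have h1 : HasDerivAt (fun s : ℝ => x + s • w) w s := by
        simpa using ((hasDerivAt_id s).smul_const w).const_add x
      exact ((hc.differentiable (by simp) _).hasFDerivAt.comp_hasDerivAt s h1))
  have hconst : (fun s : ℝ => ∫ t, descend b f (t + toTorus b (s • w)) ∂torusMeasure n) =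
      fun _ => ∫ t, descend b f t ∂torusMeasure n := by
    funext s
    exact integral_add_right_eq_self _ _
  have h0 := key.2
  rw [hconst] at h0
  have h1 := h0.unique (hasDerivAt_const _ _)
  rw [integral_add_right_eq_self] at h1
  exact h1

end torus

/-- The character `x ↦ exp (2πi v·x)`. -/
noncomputable def planeWave {n : ℕ} (v x : E n) : ℂ :=
  Complex.exp (2 * Real.pi * Complex.I * (inner ℝ v x : ℝ))

section green

variable {n : ℕ} {b : Module.Basis (Fin n) ℝ (E n)} {F : Type*} [NormedAddCommGroup F]
  [NormedSpace ℂ F]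

/-- Green's formula on the torus. -/
theorem integral_green [CompleteSpace F] {f : E n → F} {e : E n → ℂ}
    (hf : IsPeriodic b f) (he : IsPeriodic b e) (hfc : ContDiff ℝ ∞ f) (hec : ContDiff ℝ ∞ e) :
    ∫ t, descend b (fun x => e x • sndDerivTrace f x - sndDerivTrace e x • f x) t
      ∂torusMeasure n = 0 := by
  let u (i : Fin n) : E n := EuclideanSpace.basisFun (Fin n) ℝ i
  have hf' : ContDiff ℝ ∞ (fderiv ℝ f) := hfc.fderiv_right (m := ∞) le_rfl
  have he' : ContDiff ℝ ∞ (fderiv ℝ e) := hec.fderiv_right (m := ∞) le_rfl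
  -- the integrand is the divergence of the periodic field with components `e ∂ᵢf - f ∂ᵢe`
  let h (i : Fin n) (x : E n) : F := e x • fderiv ℝ f x (u i) - fderiv ℝ e x (u i) • f x
  have hh : ∀ i, ContDiff ℝ ∞ (h i) := fun i =>
    (hec.smul (hf'.clm_apply contDiff_const)).sub ((he'.clm_apply contDiff_const).smul hfc)
  have hp : ∀ i, IsPeriodic b (h i) := by
    intro i t ht x
    simp only [h, he t ht x, hf t ht x, hf.fderiv t ht x, he.fderiv t ht x]
  have hd : ∀ i x, fderiv ℝ (h i) x (u i) = e x • fderiv ℝ (fderiv ℝ f) x (u i) (u i)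
      - fderiv ℝ (fderiv ℝ e) x (u i) (u i) • f x := by
    intro i x
    have e1 := (hec.differentiable (by simp) x).hasFDerivAt
    have f1 := (hfc.differentiable (by simp) x).hasFDerivAt
    have e2 := ((he'.differentiable (by simp) x).hasFDerivAt).clm_apply
      (hasFDerivAt_const (u i) x)
    have f2 := ((hf'.differentiable (by simp) x).hasFDerivAt).clm_apply
      (hasFDerivAt_const (u i) x)
    have := (e1.smul f2).sub (e2.smul f1)
    have h3 : HasFDerivAt (h i) _ x := this
    rw [h3.fderiv]
    simp only [sub_apply, add_apply, smul_apply, ContinuousLinearMap.smulRight_apply,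
      ContinuousLinearMap.comp_zero, ContinuousLinearMap.flip_apply, zero_add]
    abel
  have hsum : (fun x => e x • sndDerivTrace f x - sndDerivTrace e x • f x) =
      fun x => ∑ i, fderiv ℝ (h i) x (u i) := by
    funext x
    simp only [hd, Finset.sum_sub_distrib, sndDerivTrace, Finset.smul_sum, Finset.sum_smul]
    rfl
  rw [hsum]
  have hint : ∀ i, Integrable (descend b fun x => fderiv ℝ (h i) x (u i)) (torusMeasure n) :=
    fun i => integrable_torus (continuous_descend
      (fun t ht x => congrArg (fun T : E n →L[ℝ] F => T (u i)) ((hp i).fderiv t ht x))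
      (((hh i).continuous_fderiv (by simp)).clm_apply continuous_const))
  change ∫ t, ∑ i, descend b (fun x => fderiv ℝ (h i) x (u i)) t ∂torusMeasure n = 0
  rw [integral_finsetSum _ fun i _ => hint i]
  exact Finset.sum_eq_zero fun i _ =>
    integral_descend_fderiv (hp i) ((hh i).of_le (by norm_cast)) (u i)

theorem contDiff_planeWave (v : E n) : ContDiff ℝ ∞ (planeWave v) := by
  unfold planeWave
  refine ContDiff.cexp (contDiff_const.mul ?_)
  exact Complex.ofRealCLM.contDiff.comp (contDiff_const.inner ℝ contDiff_id)

theorem hasFDerivAt_planeWave (v x : E n) : HasFDerivAt (planeWave v)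
    (planeWave v x • (2 * Real.pi * Complex.I) • Complex.ofRealCLM.comp (innerSL ℝ v)) x := by
  have h1 : HasFDerivAt (fun y : E n => ((inner ℝ v y : ℝ) : ℂ))
      (Complex.ofRealCLM.comp (innerSL ℝ v)) x :=
    (Complex.ofRealCLM.comp (innerSL ℝ v)).hasFDerivAt
  exact (h1.const_mul _).cexp

theorem fderiv_planeWave_apply (v x w : E n) : fderiv ℝ (planeWave v) x w =
    (2 * Real.pi * Complex.I * (inner ℝ v w : ℝ)) * planeWave v x := by
  rw [(hasFDerivAt_planeWave v x).fderiv]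
  simp
  ring

theorem fderiv_fderiv_planeWave_apply (v x w : E n) : fderiv ℝ (fderiv ℝ (planeWave v)) x w w =
    (2 * Real.pi * Complex.I * (inner ℝ v w : ℝ)) ^ 2 * planeWave v x := by
  have h1 : DifferentiableAt ℝ (fderiv ℝ (planeWave v)) x :=
    differentiableAt_fderiv (contDiff_planeWave v).contDiffAt
  have h2 := (h1.hasFDerivAt.clm_apply (hasFDerivAt_const w x)).fderiv
  have h3 : (fun y => fderiv ℝ (planeWave v) y w) =
      fun y => (2 * Real.pi * Complex.I * (inner ℝ v w : ℝ)) * planeWave v y :=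
    funext fun y => fderiv_planeWave_apply v y w
  rw [h3, ((hasFDerivAt_planeWave v x).const_mul _).fderiv] at h2
  have h4 := congrArg (fun T : E n →L[ℝ] ℂ => T w) h2
  simp at h4
  rw [← h4]
  ring

theorem sndDerivTrace_planeWave (v x : E n) :
    sndDerivTrace (planeWave v) x = -(4 * Real.pi ^ 2 * ‖v‖ ^ 2 : ℝ) * planeWave v x := by
  unfold sndDerivTrace
  simp only [fderiv_fderiv_planeWave_apply]
  rw [← Finset.sum_mul]
  congr 1
  have h1 : ‖v‖ ^ 2 = ∑ i, (inner ℝ v (EuclideanSpace.basisFun (Fin n) ℝ i)) ^ 2 := by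
    rw [← (EuclideanSpace.basisFun (Fin n) ℝ).sum_sq_norm_inner_left v]
    simp
  rw [h1]
  push_cast
  rw [Finset.mul_sum, ← Finset.sum_neg_distrib]
  refine Finset.sum_congr rfl fun i _ => ?_
  rw [mul_pow, mul_pow, Complex.I_sq]
  ring

end green

section dual

variable {n : ℕ} (b : Module.Basis (Fin n) ℝ (E n))

/-- The vector of the dual lattice with given integral coordinates in the dual basis. -/
noncomputable def dualVector (k : Fin n → ℤ) : E n :=
  (InnerProductSpace.toDual ℝ (E n)).symm
    (LinearMap.toContinuousLinearMap (∑ i, (k i : ℝ) • b.coord i))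

theorem inner_dualVector (k : Fin n → ℤ) (x : E n) :
    inner ℝ (dualVector b k) x = ∑ i, (k i : ℝ) * b.repr x i := by
  rw [dualVector, InnerProductSpace.toDual_symm_apply]
  simp

theorem inner_dualVector_basis (k : Fin n → ℤ) (j : Fin n) :
    inner ℝ (dualVector b k) (b j) = (k j : ℝ) := by
  rw [inner_dualVector]
  simp [Finsupp.single_apply]

theorem dualVector_injective : Function.Injective (dualVector b) := by
  intro k l h
  funext j
  have h1 := inner_dualVector_basis b k j
  rw [h, inner_dualVector_basis] at h1
  exact_mod_cast h1.symm

theorem mFourier_toTorus (k : Fin n → ℤ) (x : E n) :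
    UnitAddTorus.mFourier k (toTorus b x) = planeWave (dualVector b k) x := by
  rw [planeWave, inner_dualVector]
  simp only [UnitAddTorus.mFourier, ContinuousMap.coe_mk, toTorus, fourier_coe_apply]
  rw [← Complex.exp_sum]
  congr 1
  push_cast
  rw [Finset.mul_sum]
  refine Finset.sum_congr rfl fun i _ => ?_
  ring

theorem isPeriodic_planeWave (k : Fin n → ℤ) : IsPeriodic b (planeWave (dualVector b k)) := by
  intro t ht x
  rw [← mFourier_toTorus, ← mFourier_toTorus]
  congr 1
  rw [toTorus_eq_iff, add_sub_cancel_left]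
  exact ht

theorem finite_dualVector_norm (μ : ℝ) : {k : Fin n → ℤ | ‖dualVector b k‖ ^ 2 = μ}.Finite := by
  refine (Set.Finite.pi' fun i => Set.finite_Icc (-⌈√μ * ‖b i‖⌉) ⌈√μ * ‖b i‖⌉).subset ?_
  intro k hk i
  have hk' : ‖dualVector b k‖ ^ 2 = μ := hk
  have h1 : |(k i : ℝ)| ≤ √μ * ‖b i‖ := by
    rw [← inner_dualVector_basis b, ← hk', Real.sqrt_sq (norm_nonneg _)]
    exact abs_real_inner_le_norm _ _
  rw [abs_le] at h1
  constructor
  · have : (-⌈√μ * ‖b i‖⌉ : ℝ) ≤ k i := by linarith [Int.le_ceil (√μ * ‖b i‖)]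
    exact_mod_cast this
  · have : (k i : ℝ) ≤ ⌈√μ * ‖b i‖⌉ := by linarith [Int.le_ceil (√μ * ‖b i‖)]
    exact_mod_cast this

variable {b} {F : Type*} [NormedAddCommGroup F] [NormedSpace ℂ F]

/-- The Fourier coefficients of an eigenfunction of the Laplacian vanish outside a sphere. -/
theorem mFourierCoeff_eq_zero [CompleteSpace F] {f : E n → F} (hf : IsPeriodic b f)
    (hfc : ContDiff ℝ ∞ f) {μ : ℝ}
    (hΔ : ∀ x, sndDerivTrace f x = -((4 * Real.pi ^ 2 * μ : ℝ) : ℂ) • f x) {k : Fin n → ℤ}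
    (hk : ‖dualVector b k‖ ^ 2 ≠ μ) : UnitAddTorus.mFourierCoeff (descend b f) k = 0 := by
  have h1 := integral_green hf (isPeriodic_planeWave b (-k)) hfc (contDiff_planeWave _)
  have h2 : dualVector b (-k) = - dualVector b k := by
    refine ext_inner_right ℝ fun y => ?_
    rw [inner_neg_left, inner_dualVector, inner_dualVector]
    simp
  set c : ℂ := ((4 * Real.pi ^ 2 * (‖dualVector b k‖ ^ 2 - μ) : ℝ) : ℂ) with hc
  have hc0 : c ≠ 0 := by
    rw [hc, Complex.ofReal_ne_zero]
    have := sub_ne_zero.mpr hk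
    positivity
  have h3 : (descend b fun x => planeWave (dualVector b (-k)) x • sndDerivTrace f x
      - sndDerivTrace (planeWave (dualVector b (-k))) x • f x) =
      fun t => c • (UnitAddTorus.mFourier (-k) t • descend b f t) := by
    funext t
    obtain ⟨x, hx⟩ : ∃ x, x = Function.surjInv (isOpenQuotientMap_toTorus b).surjective t :=
      ⟨_, rfl⟩
    have hxt : toTorus b x = t := by rw [hx]; exact Function.surjInv_eq _ _
    rw [descend, descend, ← hx, ← hxt, mFourier_toTorus, hΔ, sndDerivTrace_planeWave, h2, norm_neg,
      smul_smul, smul_smul, ← sub_smul, hc]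
    congr 1
    push_cast
    ring
  rw [h3, integral_smul] at h1
  exact (smul_eq_zero.mp h1).resolve_left hc0

/-- A periodic eigenfunction of the Laplacian is a finite sum of plane waves. -/
theorem eq_sum_planeWave [CompleteSpace F] {f : E n → F} (hf : IsPeriodic b f)
    (hfc : ContDiff ℝ ∞ f) {μ : ℝ}
    (hΔ : ∀ x, sndDerivTrace f x = -((4 * Real.pi ^ 2 * μ : ℝ) : ℂ) • f x) (x : E n) :
    f x = ∑ k ∈ (finite_dualVector_norm b μ).toFinset,
      planeWave (dualVector b k) x • UnitAddTorus.mFourierCoeff (descend b f) k := by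
  have hdc : Continuous (descend b f) := continuous_descend hf hfc.continuous
  -- apply functionals, as the summation theorem for Fourier series is scalar valued
  refine (SeparatingDual.eq_iff_forall_dual_eq (R := ℂ)).mpr fun ℓ => ?_
  let g : C(UnitAddTorus (Fin n), ℂ) := ⟨fun t => ℓ (descend b f t), ℓ.continuous.comp hdc⟩
  have hg : ∀ k, UnitAddTorus.mFourierCoeff g k =
      ℓ (UnitAddTorus.mFourierCoeff (descend b f) k) := by
    intro k
    have hint : Integrable (fun t => UnitAddTorus.mFourier (-k) t • descend b f t)
        (torusMeasure n) :=
      integrable_torus ((ContinuousMap.continuous _).smul hdc)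
    have := ℓ.integral_comp_comm hint
    simp only [map_smul] at this
    exact this
  have hsupp : ∀ k ∉ (finite_dualVector_norm b μ).toFinset, UnitAddTorus.mFourierCoeff g k = 0 := by
    intro k hk
    rw [hg, mFourierCoeff_eq_zero hf hfc hΔ (by simpa using hk), map_zero]
  have h1 := UnitAddTorus.hasSum_mFourier_series_apply_of_summable
    (summable_of_ne_finset_zero hsupp) (toTorus b x)
  have h2 := h1.unique (hasSum_sum_of_ne_finset_zero fun k hk => by rw [hsupp k hk, zero_smul])
  have h3 : g (toTorus b x) = ℓ (f x) := congrArg ℓ (descend_toTorus hf x)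
  rw [← h3, h2, map_sum]
  refine Finset.sum_congr rfl fun k _ => ?_
  rw [hg, mFourier_toTorus, map_smul, smul_eq_mul, smul_eq_mul, mul_comm]

end dual

/-! ### Traces on alternating forms -/

section trace

open Module

theorem trace_pi_eq_sum {K ι M : Type*} [Field K] [Fintype ι] [DecidableEq ι] [AddCommGroup M]
    [Module K M] [FiniteDimensional K M] (f : (ι → M) →ₗ[K] (ι → M)) :
    LinearMap.trace K (ι → M) f =
      ∑ i, LinearMap.trace K M (LinearMap.proj i ∘ₗ f ∘ₗ LinearMap.single K (fun _ => M) i) := by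
  have h : f = ∑ i, (f ∘ₗ LinearMap.single K (fun _ => M) i) ∘ₗ LinearMap.proj i := by
    refine LinearMap.ext fun x => ?_
    simp only [LinearMap.sum_apply, LinearMap.comp_apply, LinearMap.proj_apply]
    rw [← map_sum]
    congr 1
    exact (Finset.univ_sum_single x).symm
  nth_rewrite 1 [h]
  rw [map_sum]
  refine Finset.sum_congr rfl fun i _ => ?_
  rw [LinearMap.trace_comp_comm']

/-- Precomposition with an endomorphism `f` of a real vector space, on the complex valued linear
forms, has the same trace as `f`; it is expressed in coordinates here. -/
theorem trace_transpose_coordinates {M ι : Type*} [Fintype ι] [DecidableEq ι] [AddCommGroup M]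
    [Module ℝ M] (β : Basis ι ℝ M) (f : M →ₗ[ℝ] M) (g : (ι → ℂ) →ₗ[ℂ] (ι → ℂ))
    (hg : ∀ z i, g z i = β.constr ℝ z (f (β i))) :
    LinearMap.trace ℂ (ι → ℂ) g = (LinearMap.trace ℝ M f : ℂ) := by
  rw [trace_pi_eq_sum, LinearMap.trace_eq_matrix_trace ℝ β, Matrix.trace, Complex.ofReal_sum]
  refine Finset.sum_congr rfl fun i _ => ?_
  have h : LinearMap.proj i ∘ₗ g ∘ₗ LinearMap.single ℂ (fun _ => ℂ) i =
      ((β.repr (f (β i)) i : ℝ) : ℂ) • LinearMap.id := by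
    ext
    simp only [LinearMap.comp_apply, LinearMap.proj_apply, hg, LinearMap.coe_single]
    rw [Basis.constr_apply_fintype]
    simp [Pi.single_apply]
  rw [h, map_smul, LinearMap.trace_id]
  simp [LinearMap.toMatrix_apply]

variable {n p : ℕ}

theorem continuous_alternatingMap (f : E n [⋀^Fin p]→ₗ[ℝ] ℂ) : Continuous f := by
  let b := EuclideanSpace.basisFun (Fin n) ℝ
  have h : ∀ m : Fin p → E n, f m = ∑ r : Fin p → Fin n, (∏ j, inner ℝ (b (r j)) (m j)) •
      f (fun j => b (r j)) := by
    intro m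
    have h1 : m = fun j => ∑ i, inner ℝ (b i) (m j) • b i :=
      funext fun j => (b.sum_repr' (m j)).symm
    conv_lhs => rw [h1]
    change f.toMultilinearMap _ = _
    rw [MultilinearMap.map_sum]
    refine Finset.sum_congr rfl fun r _ => ?_
    exact f.toMultilinearMap.map_smul_univ _ _
  have h' : (f : (Fin p → E n) → ℂ) = _ := funext h
  rw [h']
  fun_prop

/-- Complex valued alternating forms in coordinates with respect to a basis of the exterior
power. -/
noncomputable def altEquiv {ι : Type*} [Finite ι] (β : Basis ι ℝ (⋀[ℝ]^p (E n))) :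
    Alt n p ≃ₗ[ℂ] (ι → ℂ) where
  toFun a := fun i => exteriorPower.alternatingMapLinearEquiv a.toAlternatingMap (β i)
  map_add' a a' := by
    funext i
    exact congrArg (fun T : ⋀[ℝ]^p (E n) →ₗ[ℝ] ℂ => T (β i))
      (map_add exteriorPower.alternatingMapLinearEquiv a.toAlternatingMap a'.toAlternatingMap)
  map_smul' c a := by
    have h : exteriorPower.alternatingMapLinearEquiv (c • a).toAlternatingMap =
        c • exteriorPower.alternatingMapLinearEquiv a.toAlternatingMap := by
      apply exteriorPower.linearMap_ext
      ext m
      simp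
    funext i
    exact congrArg (fun T : ⋀[ℝ]^p (E n) →ₗ[ℝ] ℂ => T (β i)) h
  invFun z :=
    { toAlternatingMap := exteriorPower.alternatingMapLinearEquiv.symm (β.constr ℝ z)
      cont := continuous_alternatingMap _ }
  left_inv a := by
    have h : β.constr ℝ (fun i => exteriorPower.alternatingMapLinearEquiv a.toAlternatingMap (β i))
        = exteriorPower.alternatingMapLinearEquiv a.toAlternatingMap :=
      β.ext fun i => β.constr_basis ℝ _ i
    ext m
    change exteriorPower.alternatingMapLinearEquiv.symm _ m = a m
    rw [h, LinearEquiv.symm_apply_apply]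
    rfl
  right_inv z := by
    funext i
    change exteriorPower.alternatingMapLinearEquiv
      (exteriorPower.alternatingMapLinearEquiv.symm (β.constr ℝ z)) (β i) = z i
    rw [LinearEquiv.apply_symm_apply, Basis.constr_basis]

instance : FiniteDimensional ℂ (Alt n p) :=
  Module.Finite.equiv (altEquiv (Module.finBasis ℝ (⋀[ℝ]^p (E n)))).symm

/-- Pull-back of alternating forms by a linear map, as a complex linear map. -/
noncomputable def altPullback (p : ℕ) (T : E n →L[ℝ] E n) : Alt n p →ₗ[ℂ] Alt n p where
  toFun a := a.compContinuousLinearMap T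
  map_add' _ _ := rfl
  map_smul' _ _ := rfl

/-- The trace of `B` on complex valued alternating `p`-forms equals its trace on the `p`-th exterior
power. -/
theorem trace_altPullback (γ : Isom n) :
    LinearMap.trace ℂ (Alt n p) (altPullback p (linOp γ)) = (extTrace p (linPart n γ) : ℂ) := by
  classical
  let β := Module.finBasis ℝ (⋀[ℝ]^p (E n))
  rw [← LinearMap.trace_conj' _ (altEquiv β), extTrace]
  refine trace_transpose_coordinates β _ _ fun z i => ?_
  obtain ⟨a, rfl⟩ := (altEquiv β).surjective z
  rw [LinearEquiv.conj_apply_apply, LinearEquiv.symm_apply_apply]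
  have h1 : β.constr ℝ (altEquiv β a) =
      exteriorPower.alternatingMapLinearEquiv a.toAlternatingMap :=
    β.ext fun i => β.constr_basis ℝ _ i
  rw [h1, ← LinearMap.comp_apply]
  change exteriorPower.alternatingMapLinearEquiv
    (altPullback p (linOp γ) a).toAlternatingMap (β i) = _
  congr 1
  apply exteriorPower.linearMap_ext
  ext m
  simp [exteriorPower.map_apply_ιMulti]
  rfl

end trace

/-! ### The holonomy representation on the coefficients of eigenforms -/

/-- The vectors `v` of the dual lattice with `‖v‖² = μ`. -/
abbrev Shell {n : ℕ} (Γ : Subgroup (Isom n)) (μ : ℝ) : Type :=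
  {v : E n // v ∈ dualLattice Γ ∧ ‖v‖ ^ 2 = μ}

section shell

variable {n : ℕ} {Γ : Subgroup (Isom n)} {μ : ℝ}

theorem inner_linOp_linOp (γ : Isom n) (v w : E n) :
    inner ℝ (linOp γ v) (linOp γ w) = inner ℝ v w := (linPart n γ).inner_map_map v w

theorem linOp_inv_mem_transLattice {γ : Isom n} (hγ : γ ∈ Γ) {t : E n} (ht : t ∈ transLattice Γ) :
    linOp γ⁻¹ t ∈ transLattice Γ := by
  obtain ⟨τ, hτ, hτ1, rfl⟩ := transLattice_apply ht
  have h1 := mem_transLattice (Γ.mul_mem (Γ.mul_mem (Γ.inv_mem hγ) hτ) hγ)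
    (by rw [linOp_mul, linOp_mul, hτ1, mul_one, linOp_inv_mul])
  have h2 : (γ⁻¹ * τ * γ) 0 = linOp γ⁻¹ (τ 0) := by
    rw [isom_mul_apply, isom_mul_apply, apply_eq_linOp_add τ, hτ1, one_apply_eq_self,
      apply_eq_linOp_add γ⁻¹, map_add, add_right_comm, ← apply_eq_linOp_add, isom_inv_apply_self,
      zero_add]
  rwa [h2] at h1

theorem linOp_mem_dualLattice {γ : Isom n} (hγ : γ ∈ Γ) {v : E n} (hv : v ∈ dualLattice Γ) :
    linOp γ v ∈ dualLattice Γ := by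
  intro t ht
  obtain ⟨k, hk⟩ := hv _ (linOp_inv_mem_transLattice hγ ht)
  refine ⟨k, ?_⟩
  rw [← hk, ← inner_linOp_linOp γ v, ← mul_apply_eq_comp, linOp_mul_inv, one_apply_eq_self]

/-- The action of the linear parts of `Γ` on a shell of the dual lattice. -/
noncomputable def shellMap (γ : Γ) (v : Shell Γ μ) : Shell Γ μ :=
  ⟨linOp γ.1 v.1, linOp_mem_dualLattice γ.2 v.2.1, by rw [norm_linOp_apply]; exact v.2.2⟩

theorem shellMap_mul (γ δ : Γ) (v : Shell Γ μ) :
    shellMap (γ * δ) v = shellMap γ (shellMap δ v) := rfl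

theorem shellMap_one (v : Shell Γ μ) : shellMap (1 : Γ) v = v := rfl

theorem shellMap_bijective (γ : Γ) : Function.Bijective (shellMap (μ := μ) γ) := by
  refine Function.bijective_iff_has_inverse.mpr ⟨shellMap γ⁻¹, fun v => ?_, fun v => ?_⟩
  · rw [← shellMap_mul, inv_mul_cancel, shellMap_one]
  · rw [← shellMap_mul, mul_inv_cancel, shellMap_one]

theorem planeWave_add (v x y : E n) : planeWave v (x + y) = planeWave v x * planeWave v y := by
  rw [planeWave, planeWave, planeWave, ← Complex.exp_add, inner_add_right]
  congr 1
  push_cast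
  ring

theorem planeWave_zero (v : E n) : planeWave v 0 = 1 := by simp [planeWave]

theorem planeWave_linOp (γ : Isom n) (v x : E n) :
    planeWave (linOp γ v) (linOp γ x) = planeWave v x := by
  rw [planeWave, planeWave, inner_linOp_linOp]

theorem planeWave_eq_one {v t : E n} (hv : v ∈ dualLattice Γ) (ht : t ∈ transLattice Γ) :
    planeWave v t = 1 := by
  obtain ⟨k, hk⟩ := hv t ht
  rw [planeWave, hk, Complex.exp_eq_one_iff]
  refine ⟨k, ?_⟩
  push_cast
  ring

theorem mem_dualLattice_iff {b : Module.Basis (Fin n) ℝ (E n)}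
    (hb : ∀ t, t ∈ transLattice Γ ↔ t ∈ Submodule.span ℤ (Set.range b)) {v : E n} :
    v ∈ dualLattice Γ ↔ ∃ k, dualVector b k = v := by
  constructor
  · intro hv
    choose k hk using fun i => hv (b i) ((hb _).mpr (Submodule.subset_span ⟨i, rfl⟩))
    refine ⟨k, ext_inner_right ℝ fun x => ?_⟩
    rw [inner_dualVector]
    conv_rhs => rw [← b.sum_repr x, inner_sum]
    refine Finset.sum_congr rfl fun i _ => ?_
    rw [inner_smul_right, hk, mul_comm]
  · rintro ⟨k, rfl⟩ t ht
    have h := (b.mem_span_iff_repr_mem ℤ t).mp ((hb t).mp ht)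
    choose l hl using h
    refine ⟨∑ i, k i * l i, ?_⟩
    rw [inner_dualVector]
    push_cast
    refine Finset.sum_congr rfl fun i _ => ?_
    rw [← hl]
    simp

theorem IsBieberbach.finite_shell (hΓ : IsBieberbach Γ) (μ : ℝ) :
    {v : E n | v ∈ dualLattice Γ ∧ ‖v‖ ^ 2 = μ}.Finite := by
  obtain ⟨b, hb⟩ := hΓ.exists_basis
  refine ((finite_dualVector_norm b μ).image (dualVector b)).subset ?_
  rintro v ⟨hv, hvμ⟩
  obtain ⟨k, rfl⟩ := (mem_dualLattice_iff hb).mp hv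
  exact ⟨k, hvμ, rfl⟩

theorem linearIndependent_planeWave : LinearIndependent ℂ (planeWave (n := n)) := by
  let χ (v : E n) : Multiplicative (E n) →* ℂ :=
    { toFun := fun x => planeWave v x.toAdd
      map_one' := planeWave_zero v
      map_mul' := fun x y => planeWave_add v _ _ }
  have hχ : Function.Injective χ := by
    intro v w h
    have h1 : planeWave v = planeWave w := funext fun x =>
      congrArg (fun f : Multiplicative (E n) →* ℂ => f (Multiplicative.ofAdd x)) h
    -- the derivative at `0` recovers `v` from the character
    refine ext_inner_right ℝ fun y => ?_
    have h2 := fderiv_planeWave_apply v 0 y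
    rw [h1, fderiv_planeWave_apply, planeWave_zero, mul_one, mul_one] at h2
    exact_mod_cast (mul_left_cancel₀ Complex.two_pi_I_ne_zero h2).symm
  have h1 := ((linearIndependent_monoidHom (Multiplicative (E n)) ℂ).comp χ hχ).map'
    (LinearEquiv.funCongrLeft ℂ ℂ (Multiplicative.ofAdd (α := E n))).toLinearMap
    (LinearEquiv.ker _)
  have h2 : planeWave (n := n) =
      (LinearEquiv.funCongrLeft ℂ ℂ (Multiplicative.ofAdd (α := E n))).toLinearMap ∘
        (fun f : Multiplicative (E n) →* ℂ => (f : Multiplicative (E n) → ℂ)) ∘ χ := by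
    funext v x
    rfl
  rw [h2]
  exact h1

end shell

section waves

variable {n p : ℕ} {Γ : Subgroup (Isom n)} {μ : ℝ}

theorem sndDerivTrace_sum {F ι : Type*} [NormedAddCommGroup F] [NormedSpace ℝ F] (s : Finset ι)
    {f : ι → E n → F} (hf : ∀ i, ContDiff ℝ ∞ (f i)) (x : E n) :
    sndDerivTrace (fun y => ∑ i ∈ s, f i y) x = ∑ i ∈ s, sndDerivTrace (f i) x := by
  have h1 : fderiv ℝ (fun y => ∑ i ∈ s, f i y) = fun y => ∑ i ∈ s, fderiv ℝ (f i) y :=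
    funext fun y => fderiv_fun_sum fun i _ => (hf i).differentiable (by simp) y
  unfold sndDerivTrace
  rw [h1, fderiv_fun_sum fun i _ => differentiableAt_fderiv (hf i).contDiffAt]
  simp only [sum_apply]
  exact Finset.sum_comm

theorem sndDerivTrace_smul_const {F : Type*} [NormedAddCommGroup F] [NormedSpace ℂ F]
    {e : E n → ℂ} (he : ContDiff ℝ ∞ e) (a : F) (x : E n) :
    sndDerivTrace (fun y => e y • a) x = sndDerivTrace e x • a := by
  let L : ℂ →L[ℝ] F := (ContinuousLinearMap.toSpanSingleton ℂ a).restrictScalars ℝ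
  have h1 : fderiv ℝ (fun y => e y • a) = fun y => L.comp (fderiv ℝ e y) :=
    funext fun y => (L.hasFDerivAt.comp y (he.differentiable (by simp) y).hasFDerivAt).fderiv
  have h2 : HasFDerivAt (fun y => L.comp (fderiv ℝ e y))
      ((ContinuousLinearMap.compL ℝ (E n) ℂ F L).comp (fderiv ℝ (fderiv ℝ e) x)) x :=
    ((ContinuousLinearMap.compL ℝ (E n) ℂ F L).hasFDerivAt (x := fderiv ℝ e x)).comp x
      (differentiableAt_fderiv he.contDiffAt).hasFDerivAt
  unfold sndDerivTrace
  rw [h1, h2.fderiv, Finset.sum_smul]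
  rfl

/-- The form `∑ᵥ exp (2πi v·x) cᵥ` with constant coefficients `cᵥ`. -/
noncomputable def waveSum [Fintype (Shell Γ μ)] :
    (Shell Γ μ → Alt n p) →ₗ[ℂ] (E n → Alt n p) where
  toFun c x := ∑ v, planeWave v.1 x • c v
  map_add' c d := by
    funext x
    simp only [Pi.add_apply, smul_add, Finset.sum_add_distrib]
  map_smul' r c := by
    funext x
    simp only [Pi.smul_apply, RingHom.id_apply, Finset.smul_sum]
    exact Finset.sum_congr rfl fun v _ => smul_comm _ _ _

theorem waveSum_injective [Fintype (Shell Γ μ)] :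
    Function.Injective (waveSum (p := p) (Γ := Γ) (μ := μ)) := by
  refine (injective_iff_map_eq_zero _).mpr fun c hc => ?_
  funext v
  ext m
  have h1 : LinearIndependent ℂ fun v : Shell Γ μ => planeWave v.1 :=
    linearIndependent_planeWave.comp _ Subtype.val_injective
  refine Fintype.linearIndependent_iff.mp h1 (fun v => c v m) ?_ v
  funext x
  have h2 := congrArg (fun a : Alt n p => a m) (congrFun hc x)
  simp only [waveSum, LinearMap.coe_mk, AddHom.coe_mk, ContinuousAlternatingMap.sum_apply,
    ContinuousAlternatingMap.smul_apply] at h2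
  rw [Finset.sum_apply]
  refine Eq.trans ?_ h2
  exact Finset.sum_congr rfl fun v _ => mul_comm _ _

/-- The pull-back of forms by `γ`, expressed by the coefficients of plane waves. -/
noncomputable def coeffPullback (p : ℕ) (μ : ℝ) (γ : Γ) :
    (Shell Γ μ → Alt n p) →ₗ[ℂ] (Shell Γ μ → Alt n p) where
  toFun c u := planeWave (shellMap γ u).1 (γ.1 0) • altPullback p (linOp γ.1) (c (shellMap γ u))
  map_add' c d := by
    funext u
    simp only [Pi.add_apply, map_add, smul_add]
  map_smul' r c := by
    funext u
    simp only [Pi.smul_apply, map_smul, RingHom.id_apply]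
    exact smul_comm _ _ _

theorem coeffPullback_apply (γ : Γ) (c : Shell Γ μ → Alt n p) (u : Shell Γ μ) :
    coeffPullback p μ γ c u =
      planeWave (shellMap γ u).1 (γ.1 0) • altPullback p (linOp γ.1) (c (shellMap γ u)) := rfl

theorem waveSum_coeffPullback [Fintype (Shell Γ μ)] (γ : Γ) (c : Shell Γ μ → Alt n p) (x : E n) :
    waveSum (coeffPullback p μ γ c) x =
      (waveSum c (γ.1 x)).compContinuousLinearMap (linOp γ.1) := by
  change ∑ u, _ = altPullback p (linOp γ.1) (∑ v, _)
  rw [map_sum]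
  refine Eq.trans ?_ ((shellMap_bijective γ).sum_comp _)
  refine Finset.sum_congr rfl fun u _ => ?_
  rw [map_smul, apply_eq_linOp_add γ.1 x, planeWave_add, mul_smul, coeffPullback_apply]
  congr 1
  exact (planeWave_linOp γ.1 u.1 x).symm

theorem coeffPullback_mul (γ δ : Γ) :
    coeffPullback p μ (γ * δ) = coeffPullback p μ δ ∘ₗ coeffPullback p μ γ := by
  refine LinearMap.ext fun c => funext fun u => ?_
  rw [LinearMap.comp_apply, coeffPullback_apply, coeffPullback_apply, coeffPullback_apply,
    map_smul, smul_smul, shellMap_mul]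
  congr 1
  change planeWave _ ((γ.1 * δ.1) 0) = _
  rw [isom_mul_apply, apply_eq_linOp_add γ.1, planeWave_add]
  congr 1
  exact planeWave_linOp γ.1 (shellMap δ u).1 (δ.1 0)

theorem coeffPullback_one : coeffPullback p μ (1 : Γ) = LinearMap.id := by
  refine LinearMap.ext fun c => funext fun u => ?_
  rw [coeffPullback_apply]
  change planeWave _ 0 • _ = _
  rw [planeWave_zero, one_smul]
  rfl

/-- The pull-back of coefficients depends on the linear part only, as the plane waves are periodic
with respect to the translation lattice. -/
theorem coeffPullback_congr {γ δ : Γ} (h : linOp γ.1 = linOp δ.1) :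
    coeffPullback p μ γ = coeffPullback p μ δ := by
  refine LinearMap.ext fun c => funext fun u => ?_
  have h1 : shellMap γ u = shellMap δ u := by
    ext1
    change linOp γ.1 u.1 = linOp δ.1 u.1
    rw [h]
  have h2 : linOp (γ.1 * δ.1⁻¹) = 1 := by rw [linOp_mul, h, linOp_mul_inv]
  have h3 := mem_transLattice (Γ.mul_mem γ.2 (Γ.inv_mem δ.2)) h2
  have h4 : γ.1 0 = δ.1 0 + (γ.1 * δ.1⁻¹) 0 := by
    have := apply_eq_linOp_add (γ.1 * δ.1⁻¹) (δ.1 0)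
    rwa [isom_mul_apply, isom_inv_apply_self, h2, one_apply_eq_self] at this
  rw [coeffPullback_apply, coeffPullback_apply, h1, h, h4, planeWave_add,
    planeWave_eq_one (shellMap δ u).2.1 h3, mul_one]

/-- An element of `Γ` with a given linear part. -/
noncomputable def holonomyLift (B : pointGroup Γ) : Γ :=
  ⟨(Subgroup.mem_map.mp B.2).choose, (Subgroup.mem_map.mp B.2).choose_spec.1⟩

theorem linPart_holonomyLift (B : pointGroup Γ) : linPart n (holonomyLift B).1 = B :=
  (Subgroup.mem_map.mp B.2).choose_spec.2

theorem linOp_eq_of_linPart_eq {γ δ : Isom n} (h : linPart n γ = linPart n δ) :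
    linOp γ = linOp δ := by
  ext1 x
  rw [linOp_apply, linOp_apply, h]

/-- The representation of the holonomy group on the coefficients of sums of plane waves. Pull-back
reverses products, hence the inverse. -/
noncomputable def holonomyRep (Γ : Subgroup (Isom n)) (p : ℕ) (μ : ℝ) :
    Representation ℂ (pointGroup Γ) (Shell Γ μ → Alt n p) where
  toFun B := coeffPullback p μ (holonomyLift B)⁻¹
  map_one' := by
    refine Eq.trans ?_ coeffPullback_one
    refine coeffPullback_congr (linOp_eq_of_linPart_eq ?_)
    change linPart n (holonomyLift 1).1⁻¹ = linPart n 1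
    rw [map_inv, linPart_holonomyLift, map_one]
    exact inv_one
  map_mul' B C := by
    change _ = coeffPullback p μ (holonomyLift B)⁻¹ ∘ₗ coeffPullback p μ (holonomyLift C)⁻¹
    rw [← coeffPullback_mul]
    refine coeffPullback_congr (linOp_eq_of_linPart_eq ?_)
    change linPart n (holonomyLift (B * C)).1⁻¹ =
      linPart n ((holonomyLift C).1⁻¹ * (holonomyLift B).1⁻¹)
    rw [map_inv, map_mul, map_inv, map_inv, linPart_holonomyLift, linPart_holonomyLift,
      linPart_holonomyLift, Subgroup.coe_mul, mul_inv_rev]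

theorem holonomyRep_apply (B : pointGroup Γ) :
    holonomyRep Γ p μ B = coeffPullback p μ (holonomyLift B)⁻¹ := rfl

theorem mem_invariants_holonomyRep {c : Shell Γ μ → Alt n p} :
    c ∈ (holonomyRep Γ p μ).invariants ↔ ∀ γ : Γ, coeffPullback p μ γ c = c := by
  rw [Representation.mem_invariants]
  constructor
  · intro h γ
    have h1 := h ⟨linPart n γ.1⁻¹, Subgroup.mem_map_of_mem _ (Γ.inv_mem γ.2)⟩
    rw [holonomyRep_apply] at h1
    rw [← coeffPullback_congr (δ := γ) (linOp_eq_of_linPart_eq ?_)]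
    · exact h1
    · refine (map_inv (linPart n) _).trans (inv_eq_iff_eq_inv.mpr ?_)
      exact (linPart_holonomyLift _).trans (map_inv _ _)
  · exact fun h B => h _

/-! ### Multiplicities and the trace formula -/

theorem hodgeLaplacian_waveSum [Fintype (Shell Γ μ)] (c : Shell Γ μ → Alt n p) :
    ContDiff ℝ ∞ (waveSum c) ∧ ∀ x, hodgeLaplacian p (waveSum c) x =
      ((4 * Real.pi ^ 2 * μ : ℝ) : ℂ) • waveSum c x := by
  have h1 : ∀ v : Shell Γ μ, ContDiff ℝ ∞ fun x => planeWave v.1 x • c v := fun v =>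
    (contDiff_planeWave v.1).smul contDiff_const
  have h2 : ContDiff ℝ ∞ (waveSum c) := ContDiff.sum fun v _ => h1 v
  refine ⟨h2, fun x => ?_⟩
  rw [hodgeLaplacian_eq p h2.contDiffAt]
  have h3 := sndDerivTrace_sum Finset.univ h1 x
  change sndDerivTrace (waveSum c) x = _ at h3
  rw [h3, ← Finset.sum_neg_distrib]
  change _ = _ • ∑ v : Shell Γ μ, planeWave v.1 x • c v
  rw [Finset.smul_sum]
  refine Finset.sum_congr rfl fun v _ => ?_
  rw [sndDerivTrace_smul_const (contDiff_planeWave v.1), sndDerivTrace_planeWave, v.2.2, smul_smul,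
    neg_mul, neg_smul, neg_neg]

theorem IsBieberbach.exists_waveSum_eq (hΓ : IsBieberbach Γ) [Fintype (Shell Γ μ)]
    (f : invariantEigenforms Γ p (4 * Real.pi ^ 2 * μ)) :
    ∃ c : Shell Γ μ → Alt n p, waveSum c = f.1 := by
  obtain ⟨f, hfc, hfΓ, hfΔ⟩ := f
  obtain ⟨b, hb⟩ := hΓ.exists_basis
  have hper : IsPeriodic b f := by
    intro t ht x
    obtain ⟨γ, hγ, hγ1, rfl⟩ := transLattice_apply ((hb t).mpr ht)
    have h1 := hfΓ γ hγ x
    rw [apply_eq_linOp_add, hγ1, one_apply_eq_self] at h1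
    rw [h1]
    rfl
  have hΔ : ∀ x, sndDerivTrace f x = -((4 * Real.pi ^ 2 * μ : ℝ) : ℂ) • f x := by
    intro x
    have h1 := hfΔ x
    rw [hodgeLaplacian_eq p hfc.contDiffAt] at h1
    refine (neg_eq_iff_eq_neg.mp h1).trans ?_
    exact (neg_smul _ _).symm
  let S := (finite_dualVector_norm b μ).toFinset
  let ι (k : S) : Shell Γ μ := ⟨dualVector b k.1, (mem_dualLattice_iff hb).mpr ⟨k.1, rfl⟩,
    (finite_dualVector_norm b μ).mem_toFinset.mp k.2⟩
  have hι : Function.Bijective ι := by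
    constructor
    · intro k l h
      exact Subtype.ext (dualVector_injective b (congrArg Subtype.val h))
    · rintro ⟨v, hv, hvμ⟩
      obtain ⟨k, rfl⟩ := (mem_dualLattice_iff hb).mp hv
      exact ⟨⟨k, (finite_dualVector_norm b μ).mem_toFinset.mpr hvμ⟩, rfl⟩
  let e := Equiv.ofBijective ι hι
  refine ⟨fun v => UnitAddTorus.mFourierCoeff (descend b f) (e.symm v).1, ?_⟩
  funext x
  change ∑ v : Shell Γ μ, _ = f x
  rw [eq_sum_planeWave hper hfc hΔ x]
  refine (e.sum_comp _).symm.trans (Eq.trans ?_ (Finset.sum_coe_sort S _))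
  refine Finset.sum_congr rfl fun k _ => ?_
  simp only [e.symm_apply_apply]
  rfl

/-- The invariant eigenforms correspond to the invariants of the holonomy representation. -/
theorem IsBieberbach.rank_invariantEigenforms (hΓ : IsBieberbach Γ) [Fintype (Shell Γ μ)] :
    Module.rank ℂ (invariantEigenforms Γ p (4 * Real.pi ^ 2 * μ)) =
      Module.rank ℂ (holonomyRep Γ p μ).invariants := by
  have h : (holonomyRep Γ p μ).invariants.map waveSum =
      invariantEigenforms Γ p (4 * Real.pi ^ 2 * μ) := by
    ext f
    constructor
    · rintro ⟨c, hc, rfl⟩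
      obtain ⟨h1, h2⟩ := hodgeLaplacian_waveSum c
      refine ⟨h1, fun γ hγ x => ?_, h2⟩
      rw [← waveSum_coeffPullback ⟨γ, hγ⟩, mem_invariants_holonomyRep.mp hc]
    · intro hf
      obtain ⟨c, hc⟩ := hΓ.exists_waveSum_eq ⟨f, hf⟩
      refine ⟨c, mem_invariants_holonomyRep.mpr fun γ => waveSum_injective ?_, hc⟩
      funext x
      rw [waveSum_coeffPullback, hc]
      exact (hf.2.1 γ.1 γ.2 x).symm
  rw [← h]
  exact ((holonomyRep Γ p μ).invariants.equivMapOfInjective waveSum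
    waveSum_injective).rank_eq.symm

open Classical in
theorem expSum_eq_sum [Fintype (Shell Γ μ)] (γ : Γ) : expSum Γ μ γ.1 =
    ∑ u : Shell Γ μ, if shellMap γ u = u then planeWave (shellMap γ u).1 (γ.1 0) else 0 := by
  have hset : {v : E n | v ∈ dualLattice Γ ∧ ‖v‖ ^ 2 = μ ∧ linPart n γ.1 v = v} =
      ((Finset.univ.filter fun u : Shell Γ μ => shellMap γ u = u).map
        (Function.Embedding.subtype _) : Finset (E n)) := by
    ext v
    simp only [Finset.coe_map, Finset.coe_filter, Finset.mem_univ, true_and, Set.mem_image,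
      Function.Embedding.subtype_apply]
    constructor
    · rintro ⟨h1, h2, h3⟩
      exact ⟨⟨v, h1, h2⟩, Subtype.ext h3, rfl⟩
    · rintro ⟨u, hu, rfl⟩
      exact ⟨u.2.1, u.2.2, congrArg Subtype.val hu⟩
  rw [expSum, hset, finsum_mem_coe_finset, Finset.sum_map, Finset.sum_filter]
  refine Finset.sum_congr rfl fun u _ => ?_
  split_ifs with h
  · change planeWave u.1 (transPart γ.1) = _
    rw [← planeWave_linOp γ.1]
    congr 1
    exact (linPart n γ.1).apply_symm_apply _
  · rfl

theorem trace_coeffPullback [Fintype (Shell Γ μ)] (γ : Γ) :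
    LinearMap.trace ℂ (Shell Γ μ → Alt n p) (coeffPullback p μ γ) =
      extTrace p (linPart n γ.1) * expSum Γ μ γ.1 := by
  classical
  rw [trace_pi_eq_sum, expSum_eq_sum, Finset.mul_sum]
  refine Finset.sum_congr rfl fun u _ => ?_
  split_ifs with h
  · have h1 : LinearMap.proj u ∘ₗ coeffPullback p μ γ ∘ₗ LinearMap.single ℂ (fun _ => Alt n p) u =
        planeWave (shellMap γ u).1 (γ.1 0) • altPullback p (linOp γ.1) := by
      refine LinearMap.ext fun a => ?_
      rw [LinearMap.comp_apply, LinearMap.comp_apply, LinearMap.proj_apply, coeffPullback_apply,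
        LinearMap.coe_single, LinearMap.smul_apply]
      nth_rewrite 2 [h]
      rw [Pi.single_eq_same]
    rw [h1, map_smul, trace_altPullback, smul_eq_mul, mul_comm]
  · have h1 : LinearMap.proj u ∘ₗ coeffPullback p μ γ ∘ₗ LinearMap.single ℂ (fun _ => Alt n p) u =
        0 := by
      refine LinearMap.ext fun a => ?_
      rw [LinearMap.comp_apply, LinearMap.comp_apply, LinearMap.proj_apply, coeffPullback_apply,
        LinearMap.coe_single, Pi.single_eq_of_ne h, LinearMap.map_zero, LinearMap.zero_apply]
      exact smul_zero _
    rw [h1, map_zero, mul_zero]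

/-- The dimension of the invariants of a finite group is the average of the character. -/
theorem finrank_invariants_eq_average {G V : Type*} [Group G] [Finite G] [AddCommGroup V]
    [Module ℂ V] [FiniteDimensional ℂ V] (ρ : Representation ℂ G V) :
    (Module.finrank ℂ ρ.invariants : ℂ) =
      (Nat.card G : ℂ)⁻¹ * ∑ᶠ g, LinearMap.trace ℂ V (ρ g) := by
  have := Fintype.ofFinite G
  have hG : (Fintype.card G : ℂ) ≠ 0 := Nat.cast_ne_zero.mpr Fintype.card_ne_zero
  have := invertibleOfNonzero hG
  rw [← (Representation.isProj_averageMap ρ).trace, finsum_eq_sum_of_fintype,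
    Nat.card_eq_fintype_card]
  simp [GroupAlgebra.average, map_sum]

/-- The formula for multiplicities; it holds for negative `μ`, too, where both sides vanish. -/
theorem IsBieberbach.multiplicity_formula (hΓ : IsBieberbach Γ) (p : ℕ) (μ : ℝ) :
    ∃ d : ℕ, multiplicity Γ p (4 * Real.pi ^ 2 * μ) = (d : Cardinal) ∧
      (d : ℂ) = (Nat.card (pointGroup Γ) : ℂ)⁻¹ * ∑ᶠ B : pointGroup Γ,
        (extTrace p (B : E n ≃ₗᵢ[ℝ] E n) : ℂ) * eSum Γ μ B := by
  have := hΓ.finite_pointGroup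
  have : Finite (Shell Γ μ) := (hΓ.finite_shell μ).to_subtype
  have : Fintype (Shell Γ μ) := Fintype.ofFinite _
  refine ⟨Module.finrank ℂ (holonomyRep Γ p μ).invariants, ?_, ?_⟩
  · rw [hΓ.multiplicity_eq, hΓ.rank_invariantEigenforms, Module.finrank_eq_rank]
  · rw [finrank_invariants_eq_average]
    congr 1
    -- `B` acts as the pull-back by a lift of `B⁻¹`, so the sum over `F` is reordered by inversion
    refine finsum_eq_of_bijective (fun B => B⁻¹) (Equiv.inv (pointGroup Γ)).bijective fun B => ?_
    have h1 : linPart n ((holonomyLift B)⁻¹ : Γ).1 = (B⁻¹ : pointGroup Γ) := by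
      change linPart n (holonomyLift B).1⁻¹ = _
      rw [map_inv, linPart_holonomyLift]
      rfl
    rw [holonomyRep_apply, trace_coeffPullback, eSum_eq Γ μ B⁻¹ ((holonomyLift B)⁻¹).2 h1, h1]

end waves

end FlatSpec

theorem theorem3p1 (n : ℕ) :
    (∀ Γ : Subgroup (FlatSpec.Isom n), FlatSpec.IsBieberbach Γ →
      Finite (FlatSpec.pointGroup Γ) ∧
      ∀ μ : ℝ, 0 ≤ μ →
        {v : FlatSpec.E n | v ∈ FlatSpec.dualLattice Γ ∧ ‖v‖ ^ 2 = μ}.Finite ∧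
        ∀ p : ℕ, p ≤ n → ∃ d : ℕ,
          FlatSpec.multiplicity Γ p (4 * Real.pi ^ 2 * μ) = (d : Cardinal) ∧
          (d : ℂ) = (Nat.card (FlatSpec.pointGroup Γ) : ℂ)⁻¹ *
            ∑ᶠ B : FlatSpec.pointGroup Γ,
              (FlatSpec.extTrace p (B : FlatSpec.E n ≃ₗᵢ[ℝ] FlatSpec.E n) : ℂ) *
                FlatSpec.eSum Γ μ B) ∧
    (∀ Γ Γ' : Subgroup (FlatSpec.Isom n),
      FlatSpec.IsBieberbach Γ → FlatSpec.IsBieberbach Γ' →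
      ∀ p : ℕ, p ≤ n →
        (∃ Φ : FlatSpec.pointGroup Γ ≃ FlatSpec.pointGroup Γ',
          ∀ μ : ℝ, 0 ≤ μ → ∀ B : FlatSpec.pointGroup Γ,
            (FlatSpec.extTrace p (B : FlatSpec.E n ≃ₗᵢ[ℝ] FlatSpec.E n) : ℂ) *
                FlatSpec.eSum Γ μ B =
              (FlatSpec.extTrace p (Φ B : FlatSpec.E n ≃ₗᵢ[ℝ] FlatSpec.E n) : ℂ) *
                FlatSpec.eSum Γ' μ (Φ B)) →
        FlatSpec.IsIsospectral Γ Γ' p) := by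
  refine ⟨fun Γ hΓ => ⟨hΓ.finite_pointGroup, fun μ _ => ⟨hΓ.finite_shell μ, fun p _ =>
    hΓ.multiplicity_formula p μ⟩⟩, ?_⟩
  rintro Γ Γ' hΓ hΓ' p - ⟨Φ, hΦ⟩ ν
  obtain ⟨μ, rfl⟩ : ∃ μ, ν = 4 * Real.pi ^ 2 * μ :=
    ⟨ν / (4 * Real.pi ^ 2), by field_simp⟩
  obtain ⟨d, hd, hd'⟩ := hΓ.multiplicity_formula p μ
  obtain ⟨e, he, he'⟩ := hΓ'.multiplicity_formula p μ
  rw [hd, he]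
  congr 1
  have h : (d : ℂ) = e := by
    rw [hd', he', Nat.card_congr Φ]
    congr 1
    refine finsum_eq_of_bijective Φ Φ.bijective fun B => ?_
    rcases le_or_gt 0 μ with hμ | hμ
    · exact hΦ μ hμ B
    -- for `μ < 0` the sums `e_{μ,B}` are empty
    · have h0 : ∀ (Δ : Subgroup (FlatSpec.Isom n)) (C : FlatSpec.pointGroup Δ),
          FlatSpec.eSum Δ μ C = 0 := by
        intro Δ C
        refine finsum_mem_eq_zero_of_forall_eq_zero fun v hv => ?_
        exact absurd hv.2.1 (ne_of_gt (hμ.trans_le (sq_nonneg _)))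
      rw [h0, h0, mul_zero, mul_zero]
  exact_mod_cast h
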